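/- Let $K$ be a field and let $X\subseteq\mathbb A^n_K$ be an integral affine surface over $K$, i.e. the zero locus of a prime ideal $I\subset K[X_1,\dots,X_n]$ whose coordinate ring $K[X]=K[X_1,\dots,X_n]/I$ has Krull dimension $2$. Let $\overline X\subseteq\mathbb P^n_K$ be its projective closure (the Zariski closure of $X$ under the embedding $(x_1,\dots,x_n)\mapsto[1:x_1:\cdots:x_n]$, with its reduced structure), and let $X_\infty=\overline X\setminus X$ be the set of points at infinity. For an integral domain $D$ with quotient field $Q(D)$, let $R(D)$ be the subring of $Q(D)$ generated by the elements $1/d$ with $d\in D\setminus\{0\}$. Suppose that $X_\infty$ is irreducible and contains a nonsingular point of $\overline X$, i.e. a point at which the local ring of $\overline X$ is a regular local ring. Then: (a) if $K$ is algebraically closed in $K[X]$ (every element of $K[X]$ that is algebraic over $K$ lies in $K$), then $K[X]\cap R(K[X])=K$, the intersection being taken in $Q(K[X])$; (b) $\dim R(K[X])\geq 1$. -/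

import Mathlib

open MvPolynomial

noncomputable section

attribute [local instance] MvPolynomial.gradedAlgebra

/-- The reciprocal complement of an integral domain `D`: the subring of the quotient field of `D`
generated by the inverses of the nonzero elements of `D`. -/
def reciprocalComplement (D : Type*) [CommRing D] [IsDomain D] : Subring (FractionRing D) :=
  Subring.closure {y | ∃ d : D, d ≠ 0 ∧ y = (algebraMap D (FractionRing D) d)⁻¹}

/-- The standard grading by degree on `K[X₀, …, Xₙ]`. -/
abbrev projGrading (K : Type*) [Field K] (n : ℕ) :
    ℕ → Submodule K (MvPolynomial (Fin (n + 1)) K) :=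
  MvPolynomial.homogeneousSubmodule (Fin (n + 1)) K

/-- The projective space of dimension `n` over `K`, with its Zariski topology: the homogeneous
prime ideals of `K[X₀, …, Xₙ]` not containing `(X₀, …, Xₙ)`. -/
abbrev ProjSpace (K : Type*) [Field K] (n : ℕ) : Type _ :=
  ProjectiveSpectrum (projGrading K n)

/-- Dehomogenization `F(X₀, …, Xₙ) ↦ F(1, X₁, …, Xₙ)`; the affine variables are indexed by
`Fin n`, the homogenization variable is the variable with index `0`. -/
def dehomogenize (K : Type*) [Field K] (n : ℕ) :
    MvPolynomial (Fin (n + 1)) K →ₐ[K] MvPolynomial (Fin n) K :=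
  MvPolynomial.aeval (Fin.cons 1 MvPolynomial.X)

/-- The standard embedding `(x₁, …, xₙ) ↦ [1 : x₁ : ⋯ : xₙ]` of the affine space into the projective
space. On prime ideals: `p` goes to the ideal generated by the homogeneous `F` whose
dehomogenization lies in `p`. -/
def affineToProj (K : Type*) [Field K] (n : ℕ) (p : PrimeSpectrum (MvPolynomial (Fin n) K)) :
    ProjSpace K n where
  asHomogeneousIdeal :=
    (p.asIdeal.comap (dehomogenize K n)).homogeneousCore (projGrading K n)
  isPrime := (Ideal.IsPrime.comap (dehomogenize K n)).homogeneousCore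
  not_irrelevant_le := by
    intro h
    have h0 : (X 0 : MvPolynomial (Fin (n + 1)) K) ∈ HomogeneousIdeal.irrelevant (projGrading K n) := by
      rw [HomogeneousIdeal.mem_irrelevant_iff, GradedRing.proj_apply]
      exact DirectSum.decompose_of_mem_ne _ (isHomogeneous_X K (0 : Fin (n + 1))) one_ne_zero
    have h1 := Ideal.toIdeal_homogeneousCore_le (projGrading K n)
      (p.asIdeal.comap (dehomogenize K n)) (h h0)
    rw [Ideal.mem_comap] at h1
    have h2 : dehomogenize K n (X 0) = 1 := by simp [dehomogenize]
    rw [h2] at h1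
    exact p.isPrime.ne_top ((Ideal.eq_top_iff_one _).mpr h1)

/-- The affine variety defined by the ideal `I`, as a subset of the projective space. -/
def affineLocus {K : Type*} [Field K] {n : ℕ} (I : Ideal (MvPolynomial (Fin n) K)) :
    Set (ProjSpace K n) :=
  affineToProj K n '' PrimeSpectrum.zeroLocus (I : Set (MvPolynomial (Fin n) K))

/-- The projective closure of the affine variety defined by `I`. -/
def projClosure {K : Type*} [Field K] {n : ℕ} (I : Ideal (MvPolynomial (Fin n) K)) :
    Set (ProjSpace K n) :=
  closure (affineLocus I)

/-- The set of points at infinity of the affine variety defined by `I`. -/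
def pointsAtInfinity {K : Type*} [Field K] {n : ℕ} (I : Ideal (MvPolynomial (Fin n) K)) :
    Set (ProjSpace K n) :=
  projClosure I \ affineLocus I

/-- The local ring at the point `p` of the projective space: the quotients `F / G` of homogeneous
polynomials of the same degree with `G ∉ p`. -/
abbrev projLocalRing {K : Type*} [Field K] {n : ℕ} (p : ProjSpace K n) : Type _ :=
  HomogeneousLocalization.AtPrime (projGrading K n) p.asHomogeneousIdeal.toIdeal

/-- The ideal of a set `Z` in the local ring of the projective space at `p`: the germs `F / G` that
lie in the extension of the vanishing ideal of `Z`. -/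
def idealAt {K : Type*} [Field K] {n : ℕ} (Z : Set (ProjSpace K n)) (p : ProjSpace K n) :
    Ideal (projLocalRing p) :=
  ((ProjectiveSpectrum.vanishingIdeal Z).toIdeal.map
    (algebraMap (MvPolynomial (Fin (n + 1)) K)
      (Localization.AtPrime p.asHomogeneousIdeal.toIdeal))).comap
    (algebraMap (projLocalRing p) (Localization.AtPrime p.asHomogeneousIdeal.toIdeal))

/-- `p` is a nonsingular point of the closed set `Z`, taken with its reduced structure: it lies on
`Z` and the local ring of `Z` at `p` is a regular local ring. -/
def IsNonsingularPoint {K : Type*} [Field K] {n : ℕ} (Z : Set (ProjSpace K n))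
    (p : ProjSpace K n) : Prop :=
  p ∈ Z ∧ IsRegularLocalRing (projLocalRing p ⧸ idealAt Z p)

end

-- Write D = K[X]. The homogeneous coordinate ring S of the projective closure is the Rees algebra
-- of the degree filtration of D: it embeds in D[T], with X₀ going to t = T. Since X_∞ is
-- irreducible, its ideal Q in S is the only minimal prime over t. At the nonsingular point the
-- ideal of X_∞ is a prime of height at most one in a regular local ring of dimension at most two,
-- hence principal. So Q S_Q is principal, and S_Q is a valuation ring. Put V = S_Q ∩ Frac D, inside
-- Frac D[T].
--
-- Every d ∈ D lies in S[1/t]. If also d ∈ S_Q, then d has no pole along the only component of t =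
-- 0, and a dimension count makes it integral over S (`isIntegral_of_mul_pow_eq_algebraMap`),
-- although S need not be normal. Setting T = 0 in the integral equation shows that d is integral
-- over K. So V ∩ D is algebraic over K. Moreover R(D) ⊆ V: for d ≠ 0, either d ∉ S_Q and the
-- valuation property gives d⁻¹ ∈ S_Q, or d is algebraic and d⁻¹ ∈ K[d] ⊆ S_Q
-- (`exists_subring_fractionRing_of_rees`).
--
-- Part (a) follows at once. For (b), a transcendental d ∈ D has d⁻¹ ∈ R(D) but d ∉ V, so R(D) is
-- not a field.

attribute [local instance] MvPolynomial.gradedAlgebra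

/-! ### Transcendence degree and dimension of finitely generated domains -/

/-- A transcendence basis of `A ⧸ P` lifts to algebraically independent elements of `A`. If these
were a basis of `A`, a nonzero element of `P` would be algebraic over the polynomial ring they
generate, so `P` would meet that ring nontrivially; but it maps injectively to `A ⧸ P`. -/
theorem trdeg_quotient_add_one_le {K : Type*} {A : Type*} [Field K] [CommRing A] [IsDomain A]
    [Algebra K A] [Algebra.FiniteType K A] (P : Ideal A) [P.IsPrime] (hP : P ≠ ⊥) :
    Algebra.trdeg K (A ⧸ P) + 1 ≤ Algebra.trdeg K A := by
  refine Cardinal.add_one_le_of_lt ?_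
  by_contra hlt
  rw [not_lt] at hlt
  have : FaithfulSMul K (A ⧸ P) :=
    (faithfulSMul_iff_algebraMap_injective _ _).mpr (algebraMap K (A ⧸ P)).injective
  obtain ⟨s, hs⟩ := exists_isTranscendenceBasis K (A ⧸ P)
  have hfin : Algebra.trdeg K A < Cardinal.aleph0 := 
    trdeg_lt_aleph0_of_finiteType
  choose x hx using fun y : s => Ideal.Quotient.mk_surjective (I := P) (y : A ⧸ P)
  have hcomp : (Ideal.Quotient.mkₐ K P) ∘ x = Subtype.val := funext hx
  have hind : AlgebraicIndependent K x :=
    AlgebraicIndependent.of_comp (Ideal.Quotient.mkₐ K P) (by rw [hcomp]; exact hs.1)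
  have hbasis := hind.isTranscendenceBasis_of_trdeg_le hfin (hs.cardinalMk_eq_trdeg ▸ hlt)
  have := hbasis.isAlgebraic
  obtain ⟨a, haP, ha0⟩ := P.ne_bot_iff.mp hP
  obtain ⟨b, hbP, hb0⟩ := (Submodule.ne_bot_iff _).mp
    (Ideal.comap_ne_bot_of_algebraic_mem ha0 haP (this.isAlgebraic a))
  apply hb0
  obtain ⟨b, hb⟩ := b
  rw [Algebra.adjoin_range_eq_range_aeval] at hb
  obtain ⟨g, rfl⟩ := hb
  have h0 : aeval (Subtype.val : s → A ⧸ P) g = 0 := by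
    rw [← hcomp]
    have := Ideal.Quotient.eq_zero_iff_mem.mpr (Ideal.mem_comap.mp hbP)
    have h := MvPolynomial.comp_aeval_apply (f := x) (Ideal.Quotient.mkₐ K P) g
    exact h.symm.trans this
  have : g = 0 := hs.1 (by rw [h0, map_zero])
  exact Subtype.ext (by simp [this])

/-- If `(f)` were strictly smaller than `P ∩ B`, going-down would give a prime `Q < P` over `(f)`.
The height bound forces `Q = 0`, hence `f = 0`. -/
theorem Ideal.under_eq_span_singleton_of_height_le_one {B A : Type*} [CommRing B] [CommRing A] [IsDomain A]
    [IsDomain B] [Algebra B A] [FaithfulSMul B A] [Algebra.IsIntegral B A] [IsIntegrallyClosed B]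
    (P : Ideal A) [P.IsPrime] (hP : P.height ≤ 1) {f : B} (hf : Prime f)
    (hfP : algebraMap B A f ∈ P) : P.under B = Ideal.span {f} := by
  have hfp : (Ideal.span {f}).IsPrime := (Ideal.span_singleton_prime hf.ne_zero).mpr hf
  by_contra hne
  have hle : Ideal.span {f} ≤ P.under B := (Ideal.span_singleton_le_iff_mem _).mpr hfP
  obtain ⟨Q, hQ, hQp, hQf⟩ :=
    Ideal.exists_ideal_lt_liesOver_of_lt P (lt_of_le_of_ne hle (Ne.symm hne))
  have h1 : Q.height + 1 ≤ P.height := Ideal.height_add_one_le_of_lt_of_isPrime hQ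
  have h2 : Q.height = 0 := by
    have h3 := h1.trans hP
    exact Order.lt_one_iff.mp ((ENat.add_one_le_iff' ENat.one_ne_top).mp h3)
  rw [Ideal.height_eq_zero_iff_eq_bot] at h2
  subst h2
  apply hf.ne_zero
  have h3 : f ∈ (⊥ : Ideal A).under B := hQf.over ▸ Ideal.mem_span_singleton_self f
  rw [Ideal.under_def, Ideal.mem_comap, Ideal.mem_bot] at h3
  exact FaithfulSMul.algebraMap_injective B A (by rw [h3, map_zero])

theorem MvPolynomial.rename_mem_span_singleton {K σ : Type*} [Field K] {f : MvPolynomial σ K}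
    {i : σ} (hi : i ∈ f.vars) {g : MvPolynomial {j // j ≠ i} K}
    (hg : rename Subtype.val g ∈ Ideal.span {f}) : g = 0 := by
  classical
  obtain ⟨c, hc⟩ := Ideal.mem_span_singleton.mp hg
  by_contra h0
  have hr : rename (Subtype.val : {j // j ≠ i} → σ) g ≠ 0 := by
    rwa [Ne, map_eq_zero_iff _ (rename_injective _ Subtype.val_injective)]
  have hf0 : f ≠ 0 := by rintro rfl; simp at hi
  have hc0 : c ≠ 0 := by rintro rfl; simp [hr] at hc
  have h1 : i ∉ (rename (Subtype.val : {j // j ≠ i} → σ) g).vars := by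
    intro h
    obtain ⟨j, -, hj⟩ := Finset.mem_image.mp (vars_rename _ _ h)
    exact j.2 hj
  have h2 : ∀ p : MvPolynomial σ K, i ∈ p.vars ↔ degreeOf i p ≠ 0 := by
    intro p
    rw [degreeOf, Multiset.count_ne_zero, vars_def, Multiset.mem_toFinset]
  rw [h2, not_not, hc, degreeOf_mul_eq hf0 hc0] at h1
  rw [h2] at hi
  omega

section NoetherNormalization

universe u

variable {K A : Type u} [Field K] [CommRing A] [IsDomain A] [Algebra K A]

theorem trdeg_eq_of_isIntegral {s : ℕ} {g : MvPolynomial (Fin s) K →ₐ[K] A}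
    (hg : Function.Injective g) (hi : g.IsIntegral) : Algebra.trdeg K A = s := by
  algebraize [g.toRingHom]
  have : IsScalarTower K (MvPolynomial (Fin s) K) A := .of_algebraMap_eq fun x => (g.commutes x).symm
  have : FaithfulSMul (MvPolynomial (Fin s) K) A := (faithfulSMul_iff_algebraMap_injective _ _).mpr hg
  have : Algebra.IsIntegral (MvPolynomial (Fin s) K) A := ⟨hi⟩
  rw [← trdeg_add_eq K (MvPolynomial (Fin s) K) (A := A), MvPolynomial.trdeg_of_isDomain]
  simp [trdeg_eq_zero]

variable [Algebra.FiniteType K A]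

/-- Krull's theorem bounds the height of `P` by one, so `P` meets a Noether normalization in a
principal prime `(f)`. If `f` involves the variable `X i`, no nonzero polynomial in the other
variables is divisible by `f`, so these `s - 1` variables stay independent modulo `P`. -/
theorem trdeg_le_trdeg_quotient_add_one (u : A) (hu : u ≠ 0) (P : Ideal A)
    (hP : P ∈ (Ideal.span {u}).minimalPrimes) :
    Algebra.trdeg K A ≤ Algebra.trdeg K (A ⧸ P) + 1 := by
  have hPp : P.IsPrime := hP.1.1
  have : IsNoetherianRing A := Algebra.FiniteType.isNoetherianRing K A
  have hht : P.height ≤ 1 := Ideal.height_le_one_of_isPrincipal_of_mem_minimalPrimes _ P hP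
  obtain ⟨s, g, hg, hi⟩ := exists_integral_inj_algHom_of_fg K A
  rw [trdeg_eq_of_isIntegral hg hi]
  algebraize [g.toRingHom]
  have : IsScalarTower K (MvPolynomial (Fin s) K) A := .of_algebraMap_eq fun x => (g.commutes x).symm
  have : FaithfulSMul (MvPolynomial (Fin s) K) A := (faithfulSMul_iff_algebraMap_injective _ _).mpr hg
  have : Algebra.IsIntegral (MvPolynomial (Fin s) K) A := ⟨hi⟩
  have hP0 : P ≠ ⊥ := by
    rintro rfl
    exact hu (by simpa using hP.1.2)
  obtain ⟨f, hfP, hf⟩ := Ideal.IsPrime.exists_mem_prime_of_ne_bot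
    (inferInstanceAs (P.under (MvPolynomial (Fin s) K)).IsPrime)
    (Ideal.IsIntegral.comap_ne_bot (MvPolynomial (Fin s) K) hP0)
  have hspan := Ideal.under_eq_span_singleton_of_height_le_one P hht hf hfP
  have hvars : f.vars.Nonempty := by
    rw [Finset.nonempty_iff_ne_empty]
    intro h
    obtain ⟨q, hq⟩ := exists_rename_eq_of_vars_subset_range f (Fin.elim0 : Fin 0 → Fin s)
      (fun a => a.elim0) (by simp [h])
    rw [eq_C_of_isEmpty q, rename_C] at hq
    refine hf.not_isUnit (hq ▸ ((isUnit_iff_ne_zero.mpr ?_).map C))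
    intro h0
    exact hf.ne_zero (by rw [← hq, h0, map_zero])
  obtain ⟨i, hi⟩ := hvars
  have hind : AlgebraicIndependent K
      (fun j : {j : Fin s // j ≠ i} => Ideal.Quotient.mkₐ K P (g (X j.1))) := by
    rw [algebraicIndependent_iff]
    intro p hp
    refine rename_mem_span_singleton hi ?_
    rw [← hspan]
    have h1 : Ideal.Quotient.mkₐ K P (g (rename Subtype.val p)) = 0 := by
      rw [← hp, ← AlgHom.comp_apply, ← AlgHom.comp_apply]
      congr 1
      ext j
      simp
    exact (Ideal.Quotient.eq_zero_iff_mem (I := P)).mp h1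
  have := hind.lift_cardinalMk_le_trdeg
  have hs : s = (s - 1) + 1 := by have := i.2; omega
  rw [hs]
  push_cast
  gcongr
  simpa using this

theorem natCast_trdeg_eq_ringKrullDim {s : ℕ} (hs : Algebra.trdeg K A = s) : ringKrullDim A = s := by
  obtain ⟨s', g, hg, hi⟩ := exists_integral_inj_algHom_of_fg K A
  have h := trdeg_eq_of_isIntegral hg hi
  rw [hs, Nat.cast_inj] at h
  subst h
  algebraize [g.toRingHom]
  have : FaithfulSMul (MvPolynomial (Fin s) K) A := (faithfulSMul_iff_algebraMap_injective _ _).mpr hg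
  have : Algebra.IsIntegral (MvPolynomial (Fin s) K) A := ⟨hi⟩
  have hpoly : ringKrullDim (MvPolynomial (Fin s) K) = s := by simp
  rw [← hpoly]
  apply le_antisymm
  -- Incomparability bounds the dimension of `A` from above; going-down, started at a prime over the
  -- top of a chain, lifts the chain and bounds it from below.
  · refine Order.krullDim_le_of_strictMono (PrimeSpectrum.comap (algebraMap _ A)) fun P Q h => ?_
    exact Ideal.IsIntegral.comap_lt_comap (I := P.asIdeal) h
  · refine iSup_le fun l => ?_
    obtain ⟨P, hP⟩ := Algebra.IsIntegral.comap_surjective (MvPolynomial (Fin s) K) A l.last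
    have : P.asIdeal.LiesOver l.last.asIdeal := ⟨by rw [← hP]; rfl⟩
    obtain ⟨l', hl', -⟩ := Ideal.exists_ltSeries_of_hasGoingDown l P.asIdeal
    rw [← hl']
    exact le_iSup (fun l : LTSeries (PrimeSpectrum A) => (l.length : WithBot ℕ∞)) l'

theorem exists_natCast_eq_trdeg : ∃ s : ℕ, Algebra.trdeg K A = s := by
  obtain ⟨s, g, hg, hi⟩ := exists_integral_inj_algHom_of_fg K A
  exact ⟨s, trdeg_eq_of_isIntegral hg hi⟩

end NoetherNormalization

/-! ### Integrality of elements without poles -/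

/-- If `d⁻¹` is a unit in `S[d⁻¹]`, then `d` is a polynomial in `d⁻¹`; clearing denominators gives a
monic equation. -/
theorem isIntegral_of_isUnit_inv {S L : Type*} [CommRing S] [Nontrivial S] [Field L]
    [Algebra S L] {d : L}
    (hd : d ≠ 0) (u : Algebra.adjoin S {d⁻¹}) (hu : (u : L) = d⁻¹) (h : IsUnit u) :
    IsIntegral S d := by
  let := invertibleOfNonzero (inv_ne_zero hd)
  have hspan : Ideal.span {u} = ⊤ := Ideal.span_singleton_eq_top.mpr h
  have hu' : u = ⟨d⁻¹, Algebra.subset_adjoin rfl⟩ := Subtype.ext hu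
  rw [hu'] at hspan
  obtain ⟨p, hp, hpx⟩ := Algebra.exists_aeval_invOf_eq_zero_of_idealMap_adjoin_sup_span_eq_top d⁻¹
      (⊥ : Ideal S) bot_ne_top (top_unique <| hspan.ge.trans le_sup_right)
  have hmonic : p.Monic := by
    rw [Polynomial.Monic, ← sub_eq_zero]
    exact hp
  rw [invOf_eq_inv, inv_inv] at hpx
  exact ⟨p, hmonic, hpx⟩

theorem algebraMap_quotient_surjective_of_mem {S L : Type*} [CommRing S] [CommRing L]
    [Algebra S L] {x : L} (u : Algebra.adjoin S {x}) (hu : (u : L) = x)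
    (P : Ideal (Algebra.adjoin S {x})) (hP : u ∈ P) :
    Function.Surjective (algebraMap S (Algebra.adjoin S {x} ⧸ P)) := by
  intro y
  obtain ⟨y, rfl⟩ := Ideal.Quotient.mk_surjective y
  have h : (⊤ : Subalgebra S (Algebra.adjoin S {x})) ≤
      (⊥ : Subalgebra S (Algebra.adjoin S {x} ⧸ P)).comap (Ideal.Quotient.mkₐ S P) := by
    rw [← Algebra.adjoin_adjoin_coe_preimage, Algebra.adjoin_le_iff]
    intro z hz
    obtain rfl : z = u := Subtype.ext (by rw [hu]; exact hz)
    have : Ideal.Quotient.mkₐ S P z = 0 := Ideal.Quotient.eq_zero_iff_mem.mpr hP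
    change Ideal.Quotient.mkₐ S P z ∈ (⊥ : Subalgebra S _)
    rw [this]
    exact Subalgebra.zero_mem _
  exact Algebra.mem_bot.mp (h (Algebra.mem_top (x := y)))

section

universe u

/-- If `t` has a unique minimal prime `Q`, every element of the localization of `S` at `Q` which
becomes an element of `S` after multiplication by a power of `t` is integral over `S`. -/
theorem isIntegral_of_mul_pow_eq_algebraMap (K : Type u) {S L : Type u} [Field K] [CommRing S]
    [IsDomain S] [Algebra K S] [Algebra.FiniteType K S] [Field L] [Algebra S L] [FaithfulSMul S L]
    (Q : Ideal S) [Q.IsPrime] {t : S} (ht0 : t ≠ 0)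
    (htQ : t ∈ Q) (hQ : ∀ P : Ideal S, P.IsPrime → t ∈ P → Q ≤ P) {d : L} {k : ℕ} {c : S}
    (hd : d * algebraMap S L t ^ k = algebraMap S L c) {a b : S} (hb : b ∉ Q)
    (hab : d * algebraMap S L b = algebraMap S L a) : IsIntegral S d := by
  by_contra hint
  have hd0 : d ≠ 0 := by
    rintro rfl
    exact hint isIntegral_zero
  let : Algebra K L := ((algebraMap S L).comp (algebraMap K S)).toAlgebra
  have : IsScalarTower K S L := .of_algebraMap_eq fun _ => rfl
  -- As `d` is not integral, `d⁻¹` is a nonunit of `S[d⁻¹]`. A minimal prime `P` over it has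
  -- codimension at most one, whereas `P ∩ S` will have codimension at least two with residue ring
  -- mapping onto `A ⧸ P`.
  let A := Algebra.adjoin S {d⁻¹}
  let u : A := ⟨d⁻¹, Algebra.subset_adjoin rfl⟩
  have hSA : Algebra.FiniteType S A := A.fg_iff_finiteType.mp ⟨{d⁻¹}, by simp [A]⟩
  have : Algebra.FiniteType K A := Algebra.FiniteType.trans ‹_› hSA
  have hinjSA : Function.Injective (algebraMap S A) := FaithfulSMul.algebraMap_injective S A
  have hu0 : u ≠ 0 := fun h => inv_ne_zero hd0 (congrArg Subtype.val h)
  have hu : ¬ IsUnit u := fun h => hint (isIntegral_of_isUnit_inv hd0 u rfl h)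
  obtain ⟨P, hP⟩ : (Ideal.span {u}).minimalPrimes.Nonempty :=
    Set.nonempty_coe_sort.mp <| Ideal.nonempty_minimalPrimes (by rwa [Ne, Ideal.span_singleton_eq_top])
  have hPp : P.IsPrime := hP.1.1
  have huP : u ∈ P := hP.1.2 (Ideal.mem_span_singleton_self u)
  have hmem : ∀ x y : S, d * algebraMap S L x = algebraMap S L y → algebraMap S A x ∈ P := by
    intro x y hxy
    have : algebraMap S A x = u * algebraMap S A y := by
      apply Subtype.ext
      change algebraMap S L x = d⁻¹ * algebraMap S L y
      rw [← hxy, inv_mul_cancel_left₀ hd0]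
    rw [this]
    exact P.mul_mem_right _ huP
  have htP : t ∈ P.under S := by
    have := hmem (t ^ k) c (by rw [map_pow, hd])
    exact Ideal.IsPrime.mem_of_pow_mem inferInstance k this
  -- The denominator `b ∉ Q` equals `d⁻¹ * a`, hence lies in `P`: the inclusion is strict.
  have hQP : Q < P.under S := by
    refine lt_of_le_of_ne (hQ _ inferInstance htP) ?_
    rintro rfl
    exact hb (hmem b a hab)
  have hQ0 : Q ≠ ⊥ := fun h => ht0 (by simpa [h] using htQ)
  obtain ⟨s, hs⟩ := exists_natCast_eq_trdeg (K := K) (A := S)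
  have h1 := trdeg_quotient_add_one_le (K := K) Q hQ0
  have hne : (P.under S).map (Ideal.Quotient.mk Q) ≠ ⊥ := by
    rw [Ne, Ideal.map_eq_bot_iff_le_ker, Ideal.mk_ker]
    exact hQP.not_ge
  have : ((P.under S).map (Ideal.Quotient.mk Q)).IsPrime :=
    Ideal.map_isPrime_of_surjective Ideal.Quotient.mk_surjective (by simpa using hQP.le)
  have h2 := trdeg_quotient_add_one_le (K := K) _ hne
  have h3 := trdeg_le_trdeg_quotient_add_one (K := K) u hu0 P hP
  have h4 : Algebra.trdeg K S ≤ Algebra.trdeg K A :=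
    trdeg_le_of_injective (IsScalarTower.toAlgHom K S A) hinjSA
  let f : (S ⧸ Q) ⧸ (P.under S).map (Ideal.Quotient.mk Q) →ₐ[K] A ⧸ P :=
    Ideal.Quotient.liftₐ _ (Ideal.Quotient.liftₐ Q (IsScalarTower.toAlgHom K S (A ⧸ P))
      fun x hx => Ideal.Quotient.eq_zero_iff_mem.mpr (hQP.le hx)) (by
        intro x hx
        obtain ⟨y, hy, rfl⟩ := (Ideal.mem_map_iff_of_surjective _ Ideal.Quotient.mk_surjective).mp hx
        exact Ideal.Quotient.eq_zero_iff_mem.mpr hy)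
  have hf : Function.Surjective f := by
    intro y
    obtain ⟨x, rfl⟩ := algebraMap_quotient_surjective_of_mem u rfl P huP y
    exact ⟨Ideal.Quotient.mk _ (Ideal.Quotient.mk _ x), rfl⟩
  have h5 := trdeg_le_of_surjective f hf
  -- The chain `0 < Q < P ∩ S` lowers the transcendence degree by two, while passing from `A` to `A
  -- ⧸ P` lowers it by at most one.
  have h6 : Algebra.trdeg K S + 1 ≤ Algebra.trdeg K S :=
    calc Algebra.trdeg K S + 1 ≤ Algebra.trdeg K ((S ⧸ Q) ⧸ (P.under S).map (Ideal.Quotient.mk Q))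
          + 1 + 1 := by
            gcongr
            exact h4.trans (h3.trans (by gcongr))
      _ ≤ _ := (add_le_add_left h2 1).trans h1
  rw [hs] at h6
  norm_cast at h6
  omega

end

/-! ### Principal ideals in local rings -/

/-- The hypothesis `h` says that `x` generates the maximal ideal of `S_Q`. A Noetherian local domain
with principal maximal ideal is a valuation ring, so one of `a`, `b` divides the other in `S_Q`. -/
theorem exists_mul_eq_mul_of_localization_principal {S : Type*} [CommRing S] [IsDomain S]
    [IsNoetherianRing S] (Q : Ideal S) [Q.IsPrime] {x : S} (hx : x ∈ Q)
    (h : ∀ y ∈ Q, ∃ s ∉ Q, x ∣ s * y) (a b : S) :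
    ∃ e s, s ∉ Q ∧ (a * e = b * s ∨ b * e = a * s) := by
  let R := Localization.AtPrime Q
  have : IsNoetherianRing R := IsLocalization.isNoetherianRing Q.primeCompl R inferInstance
  have : IsDomain R := IsLocalization.isDomain_localization Q.primeCompl_le_nonZeroDivisors
  have hmax : (IsLocalRing.maximalIdeal R).IsPrincipal := by
    refine ⟨algebraMap S R x, le_antisymm ?_ ?_⟩
    · rw [← IsLocalization.AtPrime.map_eq_maximalIdeal Q R, Ideal.map_le_iff_le_comap]
      intro y hy
      obtain ⟨s, hs, z, hz⟩ := h y hy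
      have hu : IsUnit (algebraMap S R s) := IsLocalization.map_units R (⟨s, hs⟩ : Q.primeCompl)
      refine Ideal.mem_comap.mpr (Ideal.mem_span_singleton.mpr ?_)
      rw [← hu.dvd_mul_left, ← map_mul, hz, map_mul]
      exact dvd_mul_right _ _
    · refine (Ideal.span_singleton_le_iff_mem _).mpr ?_
      rw [← IsLocalization.AtPrime.map_eq_maximalIdeal Q R]
      exact Ideal.mem_map_of_mem _ hx
  have : ValuationRing R :=
    ((tfae_of_isNoetherianRing_of_isLocalRing_of_isDomain R).out 4 1).mp hmax
  have hinj : Function.Injective (algebraMap S R) :=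
    IsLocalization.injective R Q.primeCompl_le_nonZeroDivisors
  obtain ⟨c, hc⟩ := ValuationRing.cond (algebraMap S R a) (algebraMap S R b)
  obtain ⟨e, s, rfl⟩ := IsLocalization.exists_mk'_eq Q.primeCompl c
  refine ⟨e, s, s.2, hc.imp (fun h => ?_) fun h => ?_⟩ <;>
  · apply hinj
    rw [map_mul, map_mul, ← h, mul_assoc, IsLocalization.mk'_spec]

/-- For a prime `P` other than the maximal ideal `(b)`, each element of `P` is `b * y` with `y ∈ P`.
Thus `P = bP`, and Nakayama gives `P = 0`. -/
theorem IsLocalRing.isPrincipalIdealRing_of_isPrincipal_maximalIdeal {R : Type*} [CommRing R]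
    [IsLocalRing R] [IsNoetherianRing R] (h : (IsLocalRing.maximalIdeal R).IsPrincipal) :
    IsPrincipalIdealRing R := by
  refine IsPrincipalIdealRing.of_prime fun P hP => ?_
  by_cases hPm : P = IsLocalRing.maximalIdeal R
  · rwa [hPm]
  obtain ⟨b, hb⟩ := h
  have hle := IsLocalRing.le_maximalIdeal hP.ne_top
  have hbP : b ∉ P := fun hbP => hPm <| le_antisymm hle <| by
    rw [hb]
    exact (Ideal.span_singleton_le_iff_mem _).mpr hbP
  have h1 : P ≤ ⊥ := by
    refine Submodule.le_of_le_smul_of_le_jacobson_bot (I := IsLocalRing.maximalIdeal R)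
      (IsNoetherian.noetherian P) (IsLocalRing.maximalIdeal_le_jacobson _) ?_
    intro x hx
    have hxm := hle hx
    rw [hb] at hxm
    obtain ⟨y, rfl⟩ := Ideal.mem_span_singleton.mp hxm
    refine Submodule.mem_sup_right (Submodule.smul_mem_smul (hb ▸ Ideal.mem_span_singleton_self b) ?_)
    exact (hP.mem_or_mem hx).resolve_left hbP
  rw [le_bot_iff.mp h1]
  exact bot_isPrincipal

/-- If `q` is not maximal, some member `a` of a minimal generating set of the maximal ideal lies
outside `q`. At most one generator remains modulo `a`, so `R ⧸ (a)` is a principal ideal ring, and a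
generator of the image of `q` lifts to a generator of `q`. -/
theorem IsRegularLocalRing.isPrincipal_of_height_le_one {R : Type*} [CommRing R]
    [IsRegularLocalRing R] (hdim : ringKrullDim R ≤ 2) (q : Ideal R) [q.IsPrime]
    (hq : q.height ≤ 1) : q.IsPrincipal := by
  have hreg := (isRegularLocalRing_iff R).mp inferInstance
  have hfg : (IsLocalRing.maximalIdeal R).FG := IsNoetherian.noetherian _
  obtain ⟨s, hscard, hs⟩ := Submodule.FG.exists_span_set_encard_eq_spanFinrank hfg
  by_cases hqm : q = IsLocalRing.maximalIdeal R
  · subst hqm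
    rw [← IsLocalRing.maximalIdeal_height_eq_ringKrullDim] at hreg
    have h1 : s.encard ≤ 1 := by
      rw [hscard]
      exact_mod_cast (WithBot.coe_le_coe.mp hreg.le).trans hq
    rcases Set.encard_le_one_iff_eq.mp h1 with rfl | ⟨b, rfl⟩
    · rw [← hs, Submodule.span_empty]
      exact bot_isPrincipal
    · exact ⟨b, hs.symm⟩
  have hs2 : s.encard ≤ 2 := by
    rw [hscard]
    rw [← hreg] at hdim
    exact_mod_cast hdim
  obtain ⟨a, has, haq⟩ : ∃ a ∈ s, a ∉ q := by
    by_contra! h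
    refine hqm (le_antisymm (IsLocalRing.le_maximalIdeal Ideal.IsPrime.ne_top') ?_)
    rw [← hs]
    exact Submodule.span_le.mpr h
  have ham : a ∈ IsLocalRing.maximalIdeal R := hs ▸ Submodule.subset_span has
  have : Nontrivial (R ⧸ Ideal.span {a}) := by
    rw [Ideal.Quotient.nontrivial_iff, Ne, Ideal.span_singleton_eq_top]
    exact ham
  have : IsLocalRing (R ⧸ Ideal.span {a}) :=
    .of_surjective' (Ideal.Quotient.mk _) Ideal.Quotient.mk_surjective
  have hpir : IsPrincipalIdealRing (R ⧸ Ideal.span {a}) := by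
    apply IsLocalRing.isPrincipalIdealRing_of_isPrincipal_maximalIdeal
    have hmap : IsLocalRing.maximalIdeal (R ⧸ Ideal.span {a}) =
        Ideal.span (Ideal.Quotient.mk (Ideal.span {a}) '' s) := by
      rw [← Ideal.map_span]
      change _ = Ideal.map _ (Submodule.span R s)
      rw [hs]
      exact (IsLocalRing.map_maximalIdeal_of_surjective _ Ideal.Quotient.mk_surjective).symm
    have hone : (s \ {a}).encard ≤ 1 := by
      have := Set.encard_sdiff_singleton_add_one has
      rw [← this] at hs2
      exact (ENat.add_le_add_iff_right ENat.one_ne_top).mp (hs2.trans one_add_one_eq_two.ge)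
    have ha0 : Ideal.Quotient.mk (Ideal.span {a}) a = 0 :=
      Ideal.Quotient.eq_zero_iff_mem.mpr (Ideal.mem_span_singleton_self a)
    rw [← Set.insert_sdiff_self_of_mem has, Set.image_insert_eq, Ideal.span_insert, ha0,
      Ideal.span_singleton_eq_bot.mpr rfl, bot_sup_eq] at hmap
    rw [hmap]
    rcases Set.encard_le_one_iff_eq.mp hone with h | ⟨b, h⟩
    · rw [h, Set.image_empty, Ideal.span_empty]
      exact bot_isPrincipal
    · rw [h, Set.image_singleton]
      exact ⟨_, rfl⟩
  obtain ⟨fbar, hf⟩ := hpir.principal (q.map (Ideal.Quotient.mk (Ideal.span {a})))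
  have hfmem : fbar ∈ q.map (Ideal.Quotient.mk (Ideal.span {a})) :=
    hf ▸ Submodule.mem_span_singleton_self fbar
  obtain ⟨f, hfq, rfl⟩ :=
    (Ideal.mem_map_iff_of_surjective _ Ideal.Quotient.mk_surjective).mp hfmem
  refine ⟨f, le_antisymm ?_ ((Ideal.span_singleton_le_iff_mem _).mpr hfq)⟩
  refine Submodule.le_of_le_smul_of_le_jacobson_bot (I := Ideal.span {a})
    (IsNoetherian.noetherian q) (((Ideal.span_singleton_le_iff_mem _).mpr ham).trans
      (IsLocalRing.maximalIdeal_le_jacobson _)) ?_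
  intro x hx
  have hxm := Ideal.mem_map_of_mem (Ideal.Quotient.mk (Ideal.span {a})) hx
  rw [hf] at hxm
  obtain ⟨ybar, hy⟩ := Ideal.mem_span_singleton.mp hxm
  obtain ⟨y, rfl⟩ := Ideal.Quotient.mk_surjective ybar
  rw [← map_mul, Ideal.Quotient.mk_eq_mk_iff_sub_mem] at hy
  obtain ⟨z, hz⟩ := Ideal.mem_span_singleton.mp hy
  -- As `a ∉ q`, the relation `x = f * y + a * z` gives `q = (f) + a q`, to which Nakayama applies.
  have hzq : z ∈ q := by
    have : a * z ∈ q := hz ▸ q.sub_mem hx (q.mul_mem_right _ hfq)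
    exact (Ideal.IsPrime.mem_or_mem inferInstance this).resolve_left haq
  rw [show x = f * y + a * z by rw [← hz]; ring]
  exact Submodule.add_mem_sup (Ideal.mem_span_singleton.mpr (dvd_mul_right _ _))
    (Submodule.smul_mem_smul (Ideal.mem_span_singleton_self a) hzq)

/-! ### Homogeneous ideals, the projective closure and the points at infinity -/

theorem MvPolynomial.IsHomogeneous.aeval_mul_left {R S σ : Type*} [CommSemiring R] [CommSemiring S]
    [Algebra R S] {F : MvPolynomial σ R} {e : ℕ} (hF : F.IsHomogeneous e) (c : S) (y : σ → S) :
    MvPolynomial.aeval (fun i => c * y i) F = c ^ e * MvPolynomial.aeval y F := by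
  rw [aeval_def, aeval_def, eval₂_eq, eval₂_eq, Finset.mul_sum]
  refine Finset.sum_congr rfl fun d hd => ?_
  have hdeg : ∑ i ∈ d.support, d i = e := by
    have := hF (mem_support_iff.mp hd)
    simpa [Finsupp.weight_apply, Finsupp.sum] using this
  simp only [mul_pow, Finset.prod_mul_distrib, Finset.prod_pow_eq_pow_sum, hdeg]
  ring

section Homogeneous

variable {K : Type*} [Field K] {n : ℕ}

theorem homogeneousComponent_mem_toIdeal (J : HomogeneousIdeal (projGrading K n))
    {F : MvPolynomial (Fin (n + 1)) K} (hF : F ∈ J.toIdeal) (i : ℕ) :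
    homogeneousComponent i F ∈ J.toIdeal :=
  homogeneousComponent_mem_of_mem J.isHomogeneous hF i

theorem toIdeal_le_of_forall_isHomogeneous (J : HomogeneousIdeal (projGrading K n))
    {I : Ideal (MvPolynomial (Fin (n + 1)) K)}
    (h : ∀ i, ∀ F ∈ J.toIdeal, F.IsHomogeneous i → F ∈ I) : J.toIdeal ≤ I := by
  intro F hF
  rw [← sum_homogeneousComponent F]
  exact I.sum_mem fun i _ => h i _ (homogeneousComponent_mem_toIdeal J hF i)
    (homogeneousComponent_isHomogeneous i F)

theorem mem_homogeneousCore_iff {I : Ideal (MvPolynomial (Fin (n + 1)) K)}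
    {F : MvPolynomial (Fin (n + 1)) K} :
    F ∈ (I.homogeneousCore (projGrading K n)).toIdeal ↔ ∀ i, homogeneousComponent i F ∈ I := by
  refine ⟨fun h i => Ideal.toIdeal_homogeneousCore_le _ I (homogeneousComponent_mem_toIdeal _ h i),
    fun h => ?_⟩
  rw [← sum_homogeneousComponent F]
  exact Ideal.sum_mem _ fun i _ => Ideal.mem_homogeneousCore_of_homogeneous_of_mem
    ⟨i, homogeneousComponent_isHomogeneous i F⟩ (h i)

theorem toIdeal_le_irrelevant (J : HomogeneousIdeal (projGrading K n)) (hJ : J.toIdeal ≠ ⊤) :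
    J ≤ HomogeneousIdeal.irrelevant (projGrading K n) := by
  intro F hF
  rw [HomogeneousIdeal.mem_irrelevant_iff]
  have h := homogeneousComponent_mem_toIdeal J hF 0
  have h2 : GradedRing.proj (projGrading K n) 0 F = homogeneousComponent 0 F :=
    decomposition.decompose'_apply F 0
  rw [h2, homogeneousComponent_zero]
  rw [homogeneousComponent_zero] at h
  by_contra hne
  refine hJ (Ideal.eq_top_of_isUnit_mem _ h ?_)
  exact (isUnit_iff_ne_zero.mpr fun h0 => hne (by rw [h0, C_0])).map C

theorem dehomogenize_X_zero : dehomogenize K n (X 0) = 1 := by simp [dehomogenize]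

theorem exists_isHomogeneous_dehomogenize_eq (G : MvPolynomial (Fin n) K) :
    ∃ k, ∃ F : MvPolynomial (Fin (n + 1)) K, F.IsHomogeneous k ∧ dehomogenize K n F = G := by
  induction G using MvPolynomial.induction_on with
  | C a => exact ⟨0, C a, isHomogeneous_C _ a, by simp [dehomogenize]⟩
  | add G₁ G₂ h₁ h₂ =>
    obtain ⟨k₁, F₁, hF₁, rfl⟩ := h₁
    obtain ⟨k₂, F₂, hF₂, rfl⟩ := h₂
    refine ⟨k₁ + k₂, F₁ * X 0 ^ k₂ + F₂ * X 0 ^ k₁, ?_, ?_⟩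
    · refine (hF₁.mul (isHomogeneous_X_pow _ _)).add ?_
      exact add_comm k₁ k₂ ▸ hF₂.mul (isHomogeneous_X_pow _ _)
    · simp [dehomogenize_X_zero]
  | mul_X G i h =>
    obtain ⟨k, F, hF, rfl⟩ := h
    exact ⟨k + 1, F * X i.succ, hF.mul (isHomogeneous_X _ _), by simp [dehomogenize]⟩

end Homogeneous

section Closure

variable {K : Type*} [Field K] {n : ℕ} (I : Ideal (MvPolynomial (Fin n) K))

/-- The homogenization of the ideal `I`. -/
noncomputable def homogenization (I : Ideal (MvPolynomial (Fin n) K)) :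
    HomogeneousIdeal (projGrading K n) :=
  (I.comap (dehomogenize K n)).homogeneousCore (projGrading K n)

instance homogenization_isPrime [hI : I.IsPrime] : (homogenization I).toIdeal.IsPrime :=
  (Ideal.IsPrime.comap (dehomogenize K n)).homogeneousCore

theorem vanishingIdeal_affineLocus [hI : I.IsPrime] :
    ProjectiveSpectrum.vanishingIdeal (affineLocus I) = homogenization I := by
  apply le_antisymm
  · intro F hF
    exact (ProjectiveSpectrum.mem_vanishingIdeal _ _).mp hF _
      ⟨⟨I, hI⟩, (PrimeSpectrum.mem_zeroLocus _ _).mpr le_rfl, rfl⟩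
  · intro F hF
    refine (ProjectiveSpectrum.mem_vanishingIdeal _ _).mpr ?_
    rintro _ ⟨p, hp, rfl⟩
    exact Ideal.homogeneousCore_mono _ (Ideal.comap_mono (f := dehomogenize K n) hp) hF

theorem vanishingIdeal_projClosure [hI : I.IsPrime] :
    ProjectiveSpectrum.vanishingIdeal (projClosure I) = homogenization I := by
  rw [projClosure, ProjectiveSpectrum.vanishingIdeal_closure, vanishingIdeal_affineLocus]

theorem mem_projClosure_iff [hI : I.IsPrime] (p : ProjSpace K n) :
    p ∈ projClosure I ↔ (homogenization I).toIdeal ≤ p.asHomogeneousIdeal.toIdeal := by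
  rw [projClosure, ← ProjectiveSpectrum.zeroLocus_vanishingIdeal_eq_closure,
    vanishingIdeal_affineLocus]
  rfl

theorem X_zero_notMem_of_mem_affineLocus {p : ProjSpace K n} (hp : p ∈ affineLocus I) :
    X 0 ∉ p.asHomogeneousIdeal := by
  obtain ⟨P, -, rfl⟩ := hp
  intro h
  have h1 := Ideal.toIdeal_homogeneousCore_le _ _ h
  rw [Ideal.mem_comap, dehomogenize_X_zero] at h1
  exact P.isPrime.ne_top ((Ideal.eq_top_iff_one _).mpr h1)

theorem mem_affineLocus_of_X_zero_notMem [hI : I.IsPrime] {p : ProjSpace K n} (hp : p ∈ projClosure I)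
    (h0 : X 0 ∉ p.asHomogeneousIdeal.toIdeal) : p ∈ affineLocus I := by
  rw [mem_projClosure_iff] at hp
  let R := Localization.AtPrime p.asHomogeneousIdeal.toIdeal
  let ι : MvPolynomial (Fin (n + 1)) K →ₐ[K] R := IsScalarTower.toAlgHom K _ R
  have hu : IsUnit (ι (X 0)) :=
    IsLocalization.map_units R (⟨X 0, h0⟩ : p.asHomogeneousIdeal.toIdeal.primeCompl)
  obtain ⟨c, hc⟩ := hu.exists_right_inv
  -- With `c = 1 / X₀`, this evaluates at `X i.succ / X₀`; the affine point is the preimage of the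
  -- maximal ideal.
  let φ : MvPolynomial (Fin n) K →ₐ[K] R := aeval fun i => c * ι (X i.succ)
  have hφ : ∀ (e : ℕ) (F : MvPolynomial (Fin (n + 1)) K), F.IsHomogeneous e →
      φ (dehomogenize K n F) = c ^ e * ι F := by
    intro e F hF
    have h1 : φ.comp (dehomogenize K n) = aeval fun i => c * ι (X i) := by
      ext i
      refine Fin.cases ?_ (fun i => ?_) i
      · simp [φ, dehomogenize, mul_comm c, hc]
      · simp [φ, dehomogenize]
    have h2 : ι = aeval fun i => ι (X i) := by ext i; simp
    rw [← AlgHom.comp_apply, h1, hF.aeval_mul_left, ← h2]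
  have hcu : IsUnit c := IsUnit.of_mul_eq_one_right _ hc
  have hmem : ∀ (e : ℕ) (F : MvPolynomial (Fin (n + 1)) K), F.IsHomogeneous e →
      (φ (dehomogenize K n F) ∈ IsLocalRing.maximalIdeal R ↔
        F ∈ p.asHomogeneousIdeal.toIdeal) := by
    intro e F hF
    rw [hφ e F hF, Ideal.unit_mul_mem_iff_mem _ (hcu.pow e)]
    exact IsLocalization.AtPrime.to_map_mem_maximal_iff R p.asHomogeneousIdeal.toIdeal F
  let P : PrimeSpectrum (MvPolynomial (Fin n) K) :=
    ⟨(IsLocalRing.maximalIdeal R).comap φ, inferInstance⟩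
  refine ⟨P, ?_, ?_⟩
  · rw [PrimeSpectrum.mem_zeroLocus]
    intro G hG
    obtain ⟨k, F, hF, rfl⟩ := exists_isHomogeneous_dehomogenize_eq G
    exact (hmem k F hF).mpr
      (hp (Ideal.mem_homogeneousCore_of_homogeneous_of_mem ⟨k, hF⟩ hG))
  · refine ProjectiveSpectrum.ext (HomogeneousIdeal.ext (le_antisymm ?_ ?_))
    · refine toIdeal_le_of_forall_isHomogeneous _ fun i F hF hFi => ?_
      exact (hmem i F hFi).mp (Ideal.toIdeal_homogeneousCore_le (projGrading K n)
        (P.asIdeal.comap (dehomogenize K n)) hF)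
    · refine toIdeal_le_of_forall_isHomogeneous _ fun i F hF hFi => ?_
      exact Ideal.mem_homogeneousCore_of_homogeneous_of_mem ⟨i, hFi⟩ ((hmem i F hFi).mpr hF)

theorem mem_pointsAtInfinity_iff [hI : I.IsPrime] (p : ProjSpace K n) :
    p ∈ pointsAtInfinity I ↔ (homogenization I).toIdeal ≤ p.asHomogeneousIdeal.toIdeal ∧
      X 0 ∈ p.asHomogeneousIdeal.toIdeal := by
  rw [← mem_projClosure_iff]
  refine ⟨fun h => ⟨h.1, ?_⟩, fun h => ⟨h.1, fun h' => X_zero_notMem_of_mem_affineLocus I h' h.2⟩⟩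
  by_contra h0
  exact h.2 (mem_affineLocus_of_X_zero_notMem I h.1 h0)

/-- The vanishing ideal of the set of points at infinity. -/
noncomputable def idealAtInfinity (I : Ideal (MvPolynomial (Fin n) K)) :
    HomogeneousIdeal (projGrading K n) :=
  ProjectiveSpectrum.vanishingIdeal (pointsAtInfinity I)

theorem homogenization_le_idealAtInfinity [hI : I.IsPrime] :
    (homogenization I).toIdeal ≤ (idealAtInfinity I).toIdeal := by
  intro F hF
  exact (ProjectiveSpectrum.mem_vanishingIdeal _ _).mpr fun p hp =>
    ((mem_pointsAtInfinity_iff I p).mp hp).1 hF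

theorem X_zero_mem_idealAtInfinity [hI : I.IsPrime] : X 0 ∈ (idealAtInfinity I).toIdeal :=
  (ProjectiveSpectrum.mem_vanishingIdeal _ _).mpr fun p hp =>
    ((mem_pointsAtInfinity_iff I p).mp hp).2

theorem idealAtInfinity_le_of_mem {p : ProjSpace K n} (hp : p ∈ pointsAtInfinity I) :
    (idealAtInfinity I).toIdeal ≤ p.asHomogeneousIdeal.toIdeal := fun _ hF =>
  (ProjectiveSpectrum.mem_vanishingIdeal _ _).mp hF p hp

theorem vanishingIdeal_isPrime_of_isIrreducible {Z : Set (ProjSpace K n)} (hZ : IsIrreducible Z) :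
    (ProjectiveSpectrum.vanishingIdeal Z).toIdeal.IsPrime := by
  obtain ⟨⟨p, hp⟩, hZ⟩ := hZ
  rw [isPreirreducible_iff_isClosed_union_isClosed] at hZ
  refine ⟨fun h => p.isPrime.ne_top ?_, fun {F G} hFG => ?_⟩
  · rw [Ideal.eq_top_iff_one] at h ⊢
    exact (ProjectiveSpectrum.mem_vanishingIdeal _ _).mp h p hp
  · have hmem : ∀ H : MvPolynomial (Fin (n + 1)) K, Z ⊆ ProjectiveSpectrum.zeroLocus _ {H} →
        H ∈ (ProjectiveSpectrum.vanishingIdeal Z).toIdeal := fun H hH =>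
      (ProjectiveSpectrum.mem_vanishingIdeal _ _).mpr fun x hx => hH hx rfl
    refine (hZ _ _ (ProjectiveSpectrum.isClosed_zeroLocus _ {F})
      (ProjectiveSpectrum.isClosed_zeroLocus _ {G}) fun x hx => ?_).imp (hmem F) (hmem G)
    exact (x.isPrime.mem_or_mem ((ProjectiveSpectrum.mem_vanishingIdeal _ _).mp hFG x hx)).imp
      (fun h => by rintro _ rfl; exact h) (fun h => by rintro _ rfl; exact h)

/-- This makes the ideal of X_∞ the unique minimal prime over `X 0` even among inhomogeneous primes.
The homogeneous core of `P` is prime: either it is a point at infinity, or it contains the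
irrelevant ideal and with it every proper homogeneous ideal. -/
theorem idealAtInfinity_le_of_isPrime [hI : I.IsPrime] (hne : (pointsAtInfinity I).Nonempty)
    (P : Ideal (MvPolynomial (Fin (n + 1)) K)) [hP : P.IsPrime]
    (hJ : (homogenization I).toIdeal ≤ P) (h0 : X 0 ∈ P) : (idealAtInfinity I).toIdeal ≤ P := by
  refine le_trans ?_ (Ideal.toIdeal_homogeneousCore_le (projGrading K n) P)
  by_cases hirr : HomogeneousIdeal.irrelevant (projGrading K n) ≤ P.homogeneousCore (projGrading K n)
  · refine (toIdeal_le_irrelevant _ ?_).trans hirr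
    obtain ⟨p, hp⟩ := hne
    exact fun h => p.isPrime.ne_top (top_le_iff.mp (h ▸ idealAtInfinity_le_of_mem I hp))
  · let p : ProjSpace K n := ⟨P.homogeneousCore (projGrading K n), hP.homogeneousCore, hirr⟩
    refine idealAtInfinity_le_of_mem I (p := p) ((mem_pointsAtInfinity_iff I p).mpr ⟨?_, ?_⟩)
    · exact toIdeal_le_of_forall_isHomogeneous _ fun i F hF hFi =>
        Ideal.mem_homogeneousCore_of_homogeneous_of_mem ⟨i, hFi⟩ (hJ hF)
    · exact Ideal.mem_homogeneousCore_of_homogeneous_of_mem ⟨1, isHomogeneous_X K _⟩ h0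

end Closure

/-! ### The homogeneous coordinate ring as a Rees algebra -/

section Rees

variable {K : Type*} [Field K] {n : ℕ} (I : Ideal (MvPolynomial (Fin n) K))

/-- The homomorphism from `K[X₀, …, Xₙ]` onto the Rees algebra of the degree filtration of `K[X]`. -/
noncomputable def reesHom :
    MvPolynomial (Fin (n + 1)) K →ₐ[K] Polynomial (MvPolynomial (Fin n) K ⧸ I) :=
  aeval (Fin.cons Polynomial.X fun i => Polynomial.X * Polynomial.C (Ideal.Quotient.mk I (X i)))

theorem reesHom_X_zero : reesHom I (X 0) = Polynomial.X := by simp [reesHom]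

theorem reesHom_of_isHomogeneous {e : ℕ} {F : MvPolynomial (Fin (n + 1)) K}
    (hF : F.IsHomogeneous e) : reesHom I F =
      Polynomial.X ^ e * Polynomial.C (Ideal.Quotient.mk I (dehomogenize K n F)) := by
  let ψ : MvPolynomial (Fin n) K →ₐ[K] Polynomial (MvPolynomial (Fin n) K ⧸ I) :=
    (Polynomial.CAlgHom (R := K)).comp (Ideal.Quotient.mkₐ K I)
  have h1 : reesHom I = aeval fun i => Polynomial.X * ψ (dehomogenize K n (X i)) := by
    ext i : 1
    refine Fin.cases ?_ (fun i => ?_) i <;> simp [reesHom, dehomogenize, ψ]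
  have h2 : ψ.comp (dehomogenize K n) = aeval fun i => ψ (dehomogenize K n (X i)) := by
    ext i : 1
    simp
  rw [h1, hF.aeval_mul_left, ← h2]
  rfl

theorem coeff_reesHom (F : MvPolynomial (Fin (n + 1)) K) (i : ℕ) :
    (reesHom I F).coeff i = Ideal.Quotient.mk I (dehomogenize K n (homogeneousComponent i F)) := by
  conv_lhs => rw [← sum_homogeneousComponent F]
  simp only [map_sum, Polynomial.finsetSum_coeff,
    reesHom_of_isHomogeneous I (homogeneousComponent_isHomogeneous _ F),
    Polynomial.coeff_X_pow_mul', Polynomial.coeff_C]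
  rw [Finset.sum_eq_single i]
  · simp
  · intro j _ hj
    split_ifs with h1 h2 <;> first | rfl | omega
  · intro hi
    rw [homogeneousComponent_eq_zero i F (by simpa using hi)]
    simp

/-- The power of `Polynomial.X` records the degree, so distinct homogeneous components cannot
cancel. -/
theorem reesHom_eq_zero_iff (F : MvPolynomial (Fin (n + 1)) K) :
    reesHom I F = 0 ↔ F ∈ (homogenization I).toIdeal := by
  rw [homogenization, mem_homogeneousCore_iff, Polynomial.ext_iff]
  simp only [coeff_reesHom, Polynomial.coeff_zero, Ideal.Quotient.eq_zero_iff_mem, Ideal.mem_comap]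

theorem exists_reesHom_eq (d : MvPolynomial (Fin n) K ⧸ I) :
    ∃ k F, reesHom I F = Polynomial.X ^ k * Polynomial.C d := by
  obtain ⟨G, rfl⟩ := Ideal.Quotient.mk_surjective d
  obtain ⟨k, F, hF, rfl⟩ := exists_isHomogeneous_dehomogenize_eq G
  exact ⟨k, F, reesHom_of_isHomogeneous I hF⟩

end Rees

/-! ### Affine charts and local rings of projective space -/

section Chart

variable {K : Type*} [Field K] {n : ℕ} (p : ProjSpace K n)

theorem exists_X_notMem : ∃ i, X i ∉ p.asHomogeneousIdeal.toIdeal := by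
  by_contra! h
  refine p.not_irrelevant_le fun F hF => ?_
  rw [HomogeneousIdeal.mem_irrelevant_iff] at hF
  have h2 : homogeneousComponent 0 F = 0 := (decomposition.decompose'_apply F 0).symm.trans hF
  rw [homogeneousComponent_zero, C_eq_zero] at h2
  have hle : Ideal.span (X '' Set.univ) ≤ p.asHomogeneousIdeal.toIdeal := by
    rw [Ideal.span_le]
    rintro _ ⟨i, -, rfl⟩
    exact h i
  refine hle (mem_ideal_span_X_image.mpr fun m hm => ?_)
  by_contra! hm0
  have : m = 0 := Finsupp.ext fun i => by simpa using hm0 i (Set.mem_univ i)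
  exact mem_support_iff.mp hm (this ▸ h2)

theorem mem_comap_map_localization_iff {A : Type*} [CommRing A] {𝔭 𝔞 : Ideal A} [𝔭.IsPrime]
    [h𝔞 : 𝔞.IsPrime] (hle : 𝔞 ≤ 𝔭) (F : A) :
    algebraMap A (Localization.AtPrime 𝔭) F ∈ 𝔞.map (algebraMap A (Localization.AtPrime 𝔭)) ↔
      F ∈ 𝔞 := by
  have hd : Disjoint (𝔭.primeCompl : Set A) 𝔞 := Set.disjoint_left.mpr fun x hx hx' => hx (hle hx')
  conv_rhs => rw [← IsLocalization.under_map_of_isPrime_disjoint 𝔭.primeCompl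
    (Localization.AtPrime 𝔭) h𝔞 hd]
  rfl

/-- The ideal of the local ring at `p` defined by an ideal of the homogeneous coordinate ring. -/
noncomputable def localIdeal (𝔞 : Ideal (MvPolynomial (Fin (n + 1)) K)) : Ideal (projLocalRing p) :=
  (𝔞.map (algebraMap (MvPolynomial (Fin (n + 1)) K)
      (Localization.AtPrime p.asHomogeneousIdeal.toIdeal))).comap
    (algebraMap (projLocalRing p) (Localization.AtPrime p.asHomogeneousIdeal.toIdeal))

theorem localIdeal_isPrime {𝔞 : Ideal (MvPolynomial (Fin (n + 1)) K)} [h𝔞 : 𝔞.IsPrime]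
    (hle : 𝔞 ≤ p.asHomogeneousIdeal.toIdeal) : (localIdeal p 𝔞).IsPrime := by
  have hd : Disjoint (p.asHomogeneousIdeal.toIdeal.primeCompl : Set (MvPolynomial (Fin (n + 1)) K))
      (𝔞 : Set (MvPolynomial (Fin (n + 1)) K)) :=
    Set.disjoint_left.mpr fun x hx hx' => hx (hle hx')
  have := IsLocalization.isPrime_of_isPrime_disjoint p.asHomogeneousIdeal.toIdeal.primeCompl
    (Localization.AtPrime p.asHomogeneousIdeal.toIdeal) 𝔞 h𝔞 hd
  exact Ideal.IsPrime.comap _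

/-- Dehomogenization with respect to a coordinate not vanishing at `p`, with values in the local
ring at `p`. -/
theorem exists_chart {i : Fin (n + 1)} (hi : X i ∉ p.asHomogeneousIdeal.toIdeal) :
    ∃ φ : MvPolynomial (Fin (n + 1)) K →+* projLocalRing p, φ (X i) = 1 ∧
      (∀ r, ∃ e F G, F.IsHomogeneous e ∧ G.IsHomogeneous e ∧ G ∉ p.asHomogeneousIdeal.toIdeal ∧
        r * φ G = φ F) ∧
      (∀ e G, G.IsHomogeneous e → G ∉ p.asHomogeneousIdeal.toIdeal → IsUnit (φ G)) ∧
      ∀ 𝔞 : Ideal (MvPolynomial (Fin (n + 1)) K), 𝔞.IsPrime → 𝔞 ≤ p.asHomogeneousIdeal.toIdeal →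
        ∀ e F, F.IsHomogeneous e → (φ F ∈ localIdeal p 𝔞 ↔ F ∈ 𝔞) := by
  let L := Localization.AtPrime p.asHomogeneousIdeal.toIdeal
  let ι : MvPolynomial (Fin (n + 1)) K →ₐ[K] L := IsScalarTower.toAlgHom K _ L
  let φ : MvPolynomial (Fin (n + 1)) K →+* projLocalRing p :=
    eval₂Hom ((HomogeneousLocalization.fromZeroRingHom (projGrading K n) _).comp
      (algebraMap K (projGrading K n 0)))
      fun j => HomogeneousLocalization.mk ⟨1, ⟨X j, isHomogeneous_X K j⟩,
        ⟨X i, isHomogeneous_X K i⟩, hi⟩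
  -- This is `1 / X i`; on forms of degree `e`, the chart is multiplication by `c ^ e`.
  let c : L := Localization.mk 1 ⟨X i, hi⟩
  have hc : c * ι (X i) = 1 := by
    change Localization.mk 1 (⟨X i, hi⟩ : p.asHomogeneousIdeal.toIdeal.primeCompl) * _ = _
    rw [Localization.mk_eq_mk']
    exact (IsLocalization.mk'_spec L 1 (⟨X i, hi⟩ : p.asHomogeneousIdeal.toIdeal.primeCompl)).trans
      (map_one _)
  have hcu : IsUnit c := .of_mul_eq_one _ hc
  have hval : ∀ F, (φ F).val = aeval (fun j => c * ι (X j)) F := by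
    intro F
    have : (algebraMap (projLocalRing p) L).comp φ =
        (aeval (R := K) fun j => c * ι (X j)).toRingHom := by
      refine MvPolynomial.ringHom_ext (fun a => ?_) fun j => ?_
      · simp only [φ, RingHom.comp_apply, coe_eval₂Hom, eval₂_C]
        refine (Localization.mk_one_eq_algebraMap (M := p.asHomogeneousIdeal.toIdeal.primeCompl)
          (C a)).trans ?_
        simp [IsScalarTower.algebraMap_apply K (MvPolynomial (Fin (n + 1)) K) L]
        rfl
      · simp only [φ, RingHom.comp_apply, coe_eval₂Hom, eval₂_X, AlgHom.toRingHom_eq_coe, RingHom.coe_coe, aeval_X]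
        change Localization.mk (X j) (⟨X i, hi⟩ : p.asHomogeneousIdeal.toIdeal.primeCompl) =
          Localization.mk 1 _ * algebraMap _ _ (X j)
        rw [← Localization.mk_one_eq_algebraMap, Localization.mk_mul]
        simp
    exact congrArg (fun f : _ →+* _ => f F) this
  have hι : ι = aeval fun j => ι (X j) := by ext j; simp
  have hhom : ∀ e F, F.IsHomogeneous e → (φ F).val = c ^ e * ι F := by
    intro e F hF
    rw [hval, hF.aeval_mul_left, ← hι]
  have hunit : ∀ G, G ∉ p.asHomogeneousIdeal.toIdeal → IsUnit (ι G) := fun G hG =>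
    IsLocalization.map_units L (⟨G, hG⟩ : p.asHomogeneousIdeal.toIdeal.primeCompl)
  refine ⟨φ, ?_, fun r => ?_, fun e G hG hGp => ?_, fun 𝔞 h𝔞 hle e F hF => ?_⟩
  · apply HomogeneousLocalization.val_injective
    rw [hhom 1 _ (isHomogeneous_X K i), pow_one, hc, HomogeneousLocalization.val_one]
  · refine ⟨r.deg, r.num, r.den, r.num_mem_deg, r.den_mem_deg, r.den_mem, ?_⟩
    apply HomogeneousLocalization.val_injective
    rw [HomogeneousLocalization.val_mul, hhom _ _ r.num_mem_deg, hhom _ _ r.den_mem_deg]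
    have h := r.den_smul_val
    rw [Algebra.smul_def] at h
    change _ = c ^ r.deg * algebraMap _ _ r.num
    rw [← h]
    change r.val * (c ^ r.deg * algebraMap _ L r.den) = _
    ring
  · rw [← HomogeneousLocalization.isUnit_iff_isUnit_val, hhom e G hG]
    exact (hcu.pow e).mul (hunit G hGp)
  · rw [localIdeal, Ideal.mem_comap, HomogeneousLocalization.algebraMap_apply, hhom e F hF,
      Ideal.unit_mul_mem_iff_mem _ (hcu.pow e)]
    exact mem_comap_map_localization_iff hle F

end Chart

section Fractions

theorem ringKrullDim_le_of_forall_exists_mul_eq {B R : Type*} [CommRing B] [CommRing R]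
    (φ : B →+* R) (h : ∀ r, ∃ F G, IsUnit (φ G) ∧ r * φ G = φ F) :
    ringKrullDim R ≤ ringKrullDim B := by
  refine Order.krullDim_le_of_strictMono (PrimeSpectrum.comap φ) fun P Q hPQ => ?_
  refine lt_of_le_not_ge (Ideal.comap_mono (f := φ) hPQ.le) fun hle => hPQ.not_ge fun r hr => ?_
  obtain ⟨F, G, hG, hr'⟩ := h r
  have h1 : φ F ∈ Q.asIdeal := hr' ▸ Q.asIdeal.mul_mem_right _ hr
  have h2 : φ F ∈ P.asIdeal := hle (Ideal.mem_comap.mpr h1)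
  rw [← hr'] at h2
  exact (Ideal.mul_unit_mem_iff_mem _ hG).mp h2

end Fractions

section

variable {K : Type*} [Field K] {n : ℕ}

theorem exists_isHomogeneous_map_eq (i : Fin (n + 1)) (F : MvPolynomial (Fin (n + 1)) K) :
    ∃ (N : ℕ) (F' : MvPolynomial (Fin (n + 1)) K), F'.IsHomogeneous N ∧
      ∀ {R : Type*} [CommRing R] (φ : MvPolynomial (Fin (n + 1)) K →+* R), φ (X i) = 1 →
        φ F' = φ F := by
  refine ⟨F.totalDegree, ∑ j ∈ Finset.range (F.totalDegree + 1),
    X i ^ (F.totalDegree - j) * homogeneousComponent j F, ?_, ?_⟩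
  · refine IsHomogeneous.sum _ _ _ fun j hj => ?_
    have := (isHomogeneous_X_pow (R := K) i (F.totalDegree - j)).mul
      (homogeneousComponent_isHomogeneous j F)
    rwa [Nat.sub_add_cancel (Nat.lt_succ_iff.mp (Finset.mem_range.mp hj))] at this
  · intro R _ φ hφ
    conv_rhs => rw [← sum_homogeneousComponent F]
    simp [hφ]

variable {R : Type*} [CommRing R] {φ : MvPolynomial (Fin (n + 1)) K →+* R} {i : Fin (n + 1)}
  {P : Ideal (MvPolynomial (Fin (n + 1)) K)} {J q : HomogeneousIdeal (projGrading K n)}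
  {𝔮 : Ideal R}

/-- By `hmin`, the prime `𝔮` is minimal over the principal ideal of `φ (X 0)`, so Krull's theorem
applies. -/
theorem height_le_one_of_chart [IsNoetherianRing R] [𝔮.IsPrime]
    (hfrac : ∀ r, ∃ e F G, F.IsHomogeneous e ∧ G.IsHomogeneous e ∧ G ∉ P ∧ r * φ G = φ F)
    (hunit : ∀ e G, G.IsHomogeneous e → G ∉ P → IsUnit (φ G))
    (hJ : ∀ e F, F.IsHomogeneous e → (φ F = 0 ↔ F ∈ J.toIdeal))
    (hq : ∀ e F, F.IsHomogeneous e → (φ F ∈ 𝔮 ↔ F ∈ q.toIdeal))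
    (h0q : X 0 ∈ q.toIdeal)
    (hmin : ∀ Q : Ideal (MvPolynomial (Fin (n + 1)) K), Q.IsPrime → J.toIdeal ≤ Q → X 0 ∈ Q →
      q.toIdeal ≤ Q) : 𝔮.height ≤ 1 := by
  refine Ideal.height_le_one_of_isPrincipal_of_mem_minimalPrimes (Ideal.span {φ (X 0)}) 𝔮
    ⟨⟨inferInstance, (Ideal.span_singleton_le_iff_mem _).mpr
      ((hq 1 _ (isHomogeneous_X K 0)).mpr h0q)⟩, fun Q ⟨hQ, h0⟩ _ r hr => ?_⟩
  have hle : q.toIdeal ≤ Q.comap φ := by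
    refine hmin _ inferInstance ?_ (h0 (Ideal.mem_span_singleton_self _))
    refine toIdeal_le_of_forall_isHomogeneous J fun e F hF hFe => ?_
    rw [Ideal.mem_comap, (hJ e F hFe).mpr hF]
    exact Q.zero_mem
  obtain ⟨e, F, G, hF, hG, hGP, hr'⟩ := hfrac r
  have h1 : F ∈ q.toIdeal := (hq e F hF).mp (hr' ▸ 𝔮.mul_mem_right _ hr)
  have h2 : r * φ G ∈ Q := hr' ▸ hle h1
  exact (Ideal.mul_unit_mem_iff_mem _ (hunit e G hG hGP)).mp h2

/-- A generator of `𝔮` is a fraction of forms; its numerator `A` generates `q` modulo `J` up to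
multipliers outside `q`, that is, after localizing at `q`. -/
theorem exists_generator_of_chart (hP : P.IsPrime) (hi : X i ∉ P) (hφ : φ (X i) = 1)
    (hqP : q.toIdeal ≤ P) (hqp : q.toIdeal.IsPrime)
    (hfrac : ∀ r, ∃ e F G, F.IsHomogeneous e ∧ G.IsHomogeneous e ∧ G ∉ P ∧ r * φ G = φ F)
    (hunit : ∀ e G, G.IsHomogeneous e → G ∉ P → IsUnit (φ G))
    (hJ : ∀ e F, F.IsHomogeneous e → (φ F = 0 ↔ F ∈ J.toIdeal))
    (hq : ∀ e F, F.IsHomogeneous e → (φ F ∈ 𝔮 ↔ F ∈ q.toIdeal))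
    (h𝔮 : 𝔮.IsPrincipal) :
    ∃ A ∈ q.toIdeal, ∀ F ∈ q.toIdeal, ∃ s ∉ q.toIdeal, ∃ y, s * F - A * y ∈ J.toIdeal := by
  obtain ⟨f, hf⟩ := h𝔮
  obtain ⟨a, A, B, hA, hB, hBP, hAB⟩ := hfrac f
  have hfmem : f ∈ 𝔮 := hf ▸ Submodule.mem_span_singleton_self f
  refine ⟨A, (hq a A hA).mp (hAB ▸ 𝔮.mul_mem_right _ hfmem), ?_⟩
  have hhom : ∀ e F, F.IsHomogeneous e → F ∈ q.toIdeal →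
      ∃ s ∉ q.toIdeal, ∃ y, s * F - A * y ∈ J.toIdeal := by
    intro e F hF hFq
    have h1 : φ F ∈ 𝔮 := (hq e F hF).mpr hFq
    rw [hf] at h1
    obtain ⟨r, hr⟩ := Ideal.mem_span_singleton.mp h1
    obtain ⟨b, hb⟩ := (hunit a B hB hBP).exists_left_inv
    obtain ⟨g, H, G, hH, hG, hGP, hHG⟩ := hfrac (b * r)
    -- The powers of `X i` equalize degrees, so that `hJ` applies; they do not affect images under
    -- `φ`.
    refine ⟨G * X i ^ a, fun h => (hP.mul_notMem hGP fun h' => hi (hP.mem_of_pow_mem _ h')) (hqP h),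
      H * X i ^ e, (hJ (g + a + e) _ ?_).mp ?_⟩
    · refine IsHomogeneous.sub ((hG.mul (isHomogeneous_X_pow i a)).mul hF) ?_
      rw [show g + a + e = a + (g + e) by ring]
      exact hA.mul (hH.mul (isHomogeneous_X_pow i e))
    · simp only [map_sub, map_mul, map_pow, hφ, one_pow, mul_one]
      rw [← hAB, ← hHG, hr]
      linear_combination (-(f * r * φ G)) * hb
  intro F hF
  rw [← sum_homogeneousComponent F]
  refine Finset.sum_induction _
    (fun F => ∃ s ∉ q.toIdeal, ∃ y, s * F - A * y ∈ J.toIdeal) ?_ ?_ ?_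
  · rintro F₁ F₂ ⟨s₁, hs₁, y₁, h₁⟩ ⟨s₂, hs₂, y₂, h₂⟩
    refine ⟨s₁ * s₂, hqp.mul_notMem hs₁ hs₂, s₂ * y₁ + s₁ * y₂, ?_⟩
    have := J.toIdeal.add_mem (J.toIdeal.mul_mem_left s₂ h₁) (J.toIdeal.mul_mem_left s₁ h₂)
    convert! this using 1
    ring
  · exact ⟨1, fun h => hqp.ne_top ((Ideal.eq_top_iff_one _).mpr h), 0, by simp⟩
  · intro j _
    exact hhom j _ (homogeneousComponent_isHomogeneous j F) (homogeneousComponent_mem_toIdeal q hF j)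

end

section

universe u

variable {K : Type u} [Field K] {n : ℕ} (I : Ideal (MvPolynomial (Fin n) K)) [hI : I.IsPrime]

/-- The image `B` of `F ↦ F(X₀ / X i, …, Xₙ / X i)` in the function field has transcendence degree
at most `d`. Every element of `R` is a fraction of images of elements of `B`, so its dimension is no
larger. -/
theorem ringKrullDim_le_of_chart {d : ℕ} (hdim : ringKrullDim (MvPolynomial (Fin n) K ⧸ I) = d)
    {R : Type u} [CommRing R] {φ : MvPolynomial (Fin (n + 1)) K →+* R} {i : Fin (n + 1)}
    (hi : X i ∉ (homogenization I).toIdeal) (hφ : φ (X i) = 1)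
    (hfrac : ∀ r, ∃ F G, IsUnit (φ G) ∧ r * φ G = φ F)
    (hJ : ∀ e F, F.IsHomogeneous e → F ∈ (homogenization I).toIdeal → φ F = 0) :
    ringKrullDim R ≤ d := by
  let D := MvPolynomial (Fin n) K ⧸ I
  let x : D := Ideal.Quotient.mk I (dehomogenize K n (X i))
  have hx : algebraMap D (FractionRing D) x ≠ 0 := by
    rw [Ne, map_eq_zero_iff _ (IsFractionRing.injective D (FractionRing D)),
      Ideal.Quotient.eq_zero_iff_mem]
    exact fun h => hi (Ideal.mem_homogeneousCore_of_homogeneous_of_mem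
      ⟨1, isHomogeneous_X K i⟩ h)
  let ι : MvPolynomial (Fin (n + 1)) K →ₐ[K] FractionRing D :=
    (IsScalarTower.toAlgHom K D (FractionRing D)).comp
      ((Ideal.Quotient.mkₐ K I).comp (dehomogenize K n))
  let ψ : MvPolynomial (Fin (n + 1)) K →ₐ[K] FractionRing D :=
    aeval fun j => (algebraMap D (FractionRing D) x)⁻¹ * ι (X j)
  have hψ : ψ (X i) = 1 := by
    simp only [ψ, aeval_X]
    exact inv_mul_cancel₀ hx
  have hψhom : ∀ e F, F.IsHomogeneous e →
      ψ F = (algebraMap D (FractionRing D) x)⁻¹ ^ e * ι F := by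
    intro e F hF
    have hι : ι = aeval fun j => ι (X j) := by ext j : 1; simp
    rw [hF.aeval_mul_left, ← hι]
  have hker : ∀ F, ψ F = 0 → φ F = 0 := by
    intro F hF
    obtain ⟨N, F', hF', h⟩ := exists_isHomogeneous_map_eq i F
    rw [← h φ hφ]
    refine hJ N F' hF' (Ideal.mem_homogeneousCore_of_homogeneous_of_mem ⟨N, hF'⟩ ?_)
    have h1 : ψ F' = 0 := (h ψ.toRingHom hψ).trans hF
    rw [hψhom N F' hF', mul_eq_zero, or_iff_right (pow_ne_zero _ (inv_ne_zero hx))] at h1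
    have h2 := (map_eq_zero_iff _ (IsFractionRing.injective D (FractionRing D))).mp h1
    exact Ideal.mem_comap.mpr (Ideal.Quotient.eq_zero_iff_mem.mp h2)
  have hprime : (RingHom.ker ψ).IsPrime := RingHom.ker_isPrime ψ
  let B := MvPolynomial (Fin (n + 1)) K ⧸ RingHom.ker ψ
  have h1 : ringKrullDim R ≤ ringKrullDim B := by
    refine ringKrullDim_le_of_forall_exists_mul_eq (Ideal.Quotient.lift _ φ hker) fun r => ?_
    obtain ⟨F, G, hG, h⟩ := hfrac r
    exact ⟨Ideal.Quotient.mk _ F, Ideal.Quotient.mk _ G, hG, h⟩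
  refine h1.trans ?_
  obtain ⟨s, hs⟩ := exists_natCast_eq_trdeg (K := K) (A := D)
  obtain ⟨s', hs'⟩ := exists_natCast_eq_trdeg (K := K) (A := B)
  have hFrac : Algebra.trdeg K (FractionRing D) = s := by
    have : Algebra.IsAlgebraic D (FractionRing D) :=
      IsLocalization.isAlgebraic (FractionRing D) (nonZeroDivisors D)
    rw [← trdeg_add_eq K D (A := FractionRing D), hs, trdeg_eq_zero, add_zero]
  have hle := trdeg_le_of_injective (Ideal.kerLiftAlg ψ) (Ideal.kerLiftAlg_injective ψ)
  rw [hFrac, hs', Nat.cast_le] at hle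
  rw [natCast_trdeg_eq_ringKrullDim hs] at hdim
  rw [natCast_trdeg_eq_ringKrullDim hs', ← hdim]
  exact_mod_cast hle

theorem exists_generator_idealAtInfinity (hdim : ringKrullDim (MvPolynomial (Fin n) K ⧸ I) = 2)
    (hirr : IsIrreducible (pointsAtInfinity I))
    (hns : ∃ p ∈ pointsAtInfinity I, IsNonsingularPoint (projClosure I) p) :
    ∃ A ∈ (idealAtInfinity I).toIdeal, ∀ F ∈ (idealAtInfinity I).toIdeal,
      ∃ s ∉ (idealAtInfinity I).toIdeal, ∃ y, s * F - A * y ∈ (homogenization I).toIdeal := by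
  obtain ⟨p, hp, -, hreg⟩ := hns
  have hqp : (idealAtInfinity I).toIdeal.IsPrime := vanishingIdeal_isPrime_of_isIrreducible hirr
  have hqP := idealAtInfinity_le_of_mem I hp
  have hJP := ((mem_pointsAtInfinity_iff I p).mp hp).1
  have hidealAt : idealAt (projClosure I) p = localIdeal p (homogenization I).toIdeal := by
    rw [idealAt, vanishingIdeal_projClosure]
    rfl
  rw [hidealAt] at hreg
  obtain ⟨i, hi⟩ := exists_X_notMem p
  obtain ⟨φ, hφ, hfrac, hunit, hmem⟩ := exists_chart p hi
  let mk := Ideal.Quotient.mk (localIdeal p (homogenization I).toIdeal)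
  let φ' := mk.comp φ
  have hφ' : φ' (X i) = 1 := by rw [RingHom.comp_apply, hφ, map_one]
  have hfrac' : ∀ r, ∃ e F G, F.IsHomogeneous e ∧ G.IsHomogeneous e ∧
      G ∉ p.asHomogeneousIdeal.toIdeal ∧ r * φ' G = φ' F := by
    intro r
    obtain ⟨r, rfl⟩ := Ideal.Quotient.mk_surjective r
    obtain ⟨e, F, G, hF, hG, hGp, h⟩ := hfrac r
    exact ⟨e, F, G, hF, hG, hGp, (map_mul mk _ _).symm.trans (congrArg mk h)⟩
  have hunit' : ∀ e G, G.IsHomogeneous e → G ∉ p.asHomogeneousIdeal.toIdeal → IsUnit (φ' G) :=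
    fun e G hG hGp => (hunit e G hG hGp).map mk
  have hJ : ∀ e F, F.IsHomogeneous e → (φ' F = 0 ↔ F ∈ (homogenization I).toIdeal) :=
    fun e F hF => Ideal.Quotient.eq_zero_iff_mem.trans (hmem _ inferInstance hJP e F hF)
  let 𝔮 := (localIdeal p (idealAtInfinity I).toIdeal).map mk
  have hle : localIdeal p (homogenization I).toIdeal ≤ localIdeal p (idealAtInfinity I).toIdeal :=
    Ideal.comap_mono (Ideal.map_mono (homogenization_le_idealAtInfinity I))
  have hq : ∀ e F, F.IsHomogeneous e → (φ' F ∈ 𝔮 ↔ F ∈ (idealAtInfinity I).toIdeal) :=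
    fun e F hF => (Ideal.mem_quotient_iff_mem hle).trans (hmem _ hqp hqP e F hF)
  have := localIdeal_isPrime p hqP
  have : 𝔮.IsPrime := Ideal.map_isPrime_of_surjective Ideal.Quotient.mk_surjective (by
    rwa [Ideal.mk_ker])
  have hht : 𝔮.height ≤ 1 := height_le_one_of_chart hfrac' hunit' hJ hq
    (X_zero_mem_idealAtInfinity I) fun Q hQ => idealAtInfinity_le_of_isPrime I hirr.1 Q
  have hdim' := ringKrullDim_le_of_chart I (d := 2) hdim (φ := φ') (fun h => hi (hJP h)) hφ'
    (fun r => by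
      obtain ⟨e, F, G, -, hG, hGp, h⟩ := hfrac' r
      exact ⟨F, G, hunit' e G hG hGp, h⟩) fun e F hF => (hJ e F hF).mpr
  exact exists_generator_of_chart p.isPrime hi hφ' hqP hqp hfrac' hunit' hJ hq
    (IsRegularLocalRing.isPrincipal_of_height_le_one hdim' 𝔮 hht)

end

/-! ### The valuation ring along infinity and the reciprocal complement -/

section LocalizationSubring

/-- The localization of `S` at the prime ideal `Q`, as a subring of a field containing `S`. -/
def localizationSubring {S : Type*} (L : Type*) [CommRing S] [Field L] [Algebra S L] (Q : Ideal S)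
    [hQ : Q.IsPrime] : Subring L where
  carrier := {x | ∃ a b : S, b ∉ Q ∧ x * algebraMap S L b = algebraMap S L a}
  mul_mem' := by
    rintro x y ⟨a, b, hb, h⟩ ⟨c, d, hd, h'⟩
    refine ⟨a * c, b * d, hQ.mul_notMem hb hd, ?_⟩
    rw [map_mul, map_mul, ← h, ← h']
    ring
  one_mem' := ⟨1, 1, hQ.one_notMem, by simp⟩
  add_mem' := by
    rintro x y ⟨a, b, hb, h⟩ ⟨c, d, hd, h'⟩
    refine ⟨a * d + c * b, b * d, hQ.mul_notMem hb hd, ?_⟩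
    rw [map_mul, map_add, map_mul, map_mul, ← h, ← h']
    ring
  zero_mem' := ⟨0, 1, hQ.one_notMem, by simp⟩
  neg_mem' := by
    rintro x ⟨a, b, hb, h⟩
    exact ⟨-a, b, hb, by rw [neg_mul, h, map_neg]⟩

end LocalizationSubring

section

universe u

/-- The subring `V` is the trace on `FractionRing D` of the valuation ring `S_Q`. Elements of `D` in
it are integral over `S`, hence over `K` by `hεint`. -/
theorem exists_subring_fractionRing_of_rees {K S D : Type u} [Field K] [CommRing S] [IsDomain S]
    [Algebra K S] [Algebra.FiniteType K S] [CommRing D] [IsDomain D] [Algebra K D]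
    (ε : S →+* Polynomial D) (hε : Function.Injective ε)
    (hεK : ∀ a, ε (algebraMap K S a) = Polynomial.C (algebraMap K D a))
    (hrees : ∀ d, ∃ k c, ε c = Polynomial.X ^ k * Polynomial.C d)
    (hεint : ∀ d, ε.IsIntegralElem (Polynomial.C d) → IsIntegral K d)
    (Q : Ideal S) [Q.IsPrime] {t : S} (ht : ε t = Polynomial.X) (htQ : t ∈ Q)
    (hmin : ∀ P : Ideal S, P.IsPrime → t ∈ P → Q ≤ P) {x : S} (hx : x ∈ Q)
    (hgen : ∀ y ∈ Q, ∃ s ∉ Q, x ∣ s * y) :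
    ∃ V : Subring (FractionRing D), (∀ d : D, algebraMap D _ d ∈ V → IsAlgebraic K d) ∧
      reciprocalComplement D ≤ V := by
  let L := FractionRing (Polynomial D)
  let ρ : Polynomial D →+* L := algebraMap (Polynomial D) L
  have hρ : Function.Injective ρ := IsFractionRing.injective _ _
  let : Algebra S L := (ρ.comp ε).toAlgebra
  have : FaithfulSMul S L := (faithfulSMul_iff_algebraMap_injective _ _).mpr (hρ.comp hε)
  have : IsNoetherianRing S := Algebra.FiniteType.isNoetherianRing K S
  have ht' : algebraMap S L t = ρ Polynomial.X := congrArg ρ ht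
  have ht0 : t ≠ 0 := by
    rintro rfl
    exact Polynomial.X_ne_zero (ht.symm.trans (map_zero ε))
  have hfrac : ∀ d : D, ∃ k c, ρ (Polynomial.C d) * algebraMap S L t ^ k = algebraMap S L c := by
    intro d
    obtain ⟨k, c, hc⟩ := hrees d
    refine ⟨k, c, ?_⟩
    rw [ht', mul_comm, ← map_pow, ← map_mul, ← hc]
    rfl
  have hint : ∀ d : D, ρ (Polynomial.C d) ∈ localizationSubring L Q → IsIntegral K d := by
    rintro d ⟨a, b, hb, hab⟩
    obtain ⟨k, c, hc⟩ := hfrac d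
    obtain ⟨f, hf, hf0⟩ := isIntegral_of_mul_pow_eq_algebraMap K Q ht0 htQ hmin hc hb hab
    refine hεint d ⟨f, hf, hρ ?_⟩
    rw [Polynomial.hom_eval₂, map_zero]
    exact hf0
  have hK : ∀ a : K, ρ (Polynomial.C (algebraMap K D a)) ∈ localizationSubring L Q := by
    refine fun a => ⟨algebraMap K S a, 1, Ideal.IsPrime.one_notMem inferInstance, ?_⟩
    rw [map_one, mul_one, ← hεK]
    rfl
  have hinv : ∀ d : D, d ≠ 0 → (ρ (Polynomial.C d))⁻¹ ∈ localizationSubring L Q := by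
    intro d hd
    have hd0 : ρ (Polynomial.C d) ≠ 0 := by
      rwa [Ne, map_eq_zero_iff _ hρ, Polynomial.C_eq_zero]
    -- If `d` lies in `S_Q`, it is integral over `K` and its inverse is a polynomial in `d`.
    -- Otherwise `d = c / t ^ k`, and comparing `c` with `t ^ k` in the valuation ring puts the
    -- inverse in `S_Q`.
    by_cases hmem : ρ (Polynomial.C d) ∈ localizationSubring L Q
    · let : Algebra K L := (ρ.comp (Polynomial.C.comp (algebraMap K D))).toAlgebra
      have h := (hint d hmem).map_of_comp_eq (RingHom.id K) (ρ.comp Polynomial.C) rfl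
      let W : Subalgebra K L := { localizationSubring L Q with algebraMap_mem' := hK }
      have hle : Algebra.adjoin K {ρ (Polynomial.C d)} ≤ W :=
        Algebra.adjoin_le (Set.singleton_subset_iff.mpr hmem)
      exact hle h.inv_mem_adjoin
    · obtain ⟨k, c, hc⟩ := hfrac d
      have htk : algebraMap S L (t ^ k) ≠ 0 :=
        (map_ne_zero_iff _ (FaithfulSMul.algebraMap_injective S L)).mpr (pow_ne_zero k ht0)
      obtain ⟨e, s, hs, h | h⟩ :=
        exists_mul_eq_mul_of_localization_principal Q hx hgen c (t ^ k)
      · refine ⟨e, s, hs, ?_⟩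
        have h' := congrArg (algebraMap S L) h
        rw [map_mul, map_mul, ← hc, ← map_pow] at h'
        rw [inv_mul_eq_iff_eq_mul₀ hd0]
        exact mul_left_cancel₀ htk (by linear_combination -h')
      · refine absurd ⟨e, s, hs, ?_⟩ hmem
        have h' := congrArg (algebraMap S L) h
        rw [map_mul, map_mul, ← hc, ← map_pow] at h'
        exact mul_left_cancel₀ htk (by linear_combination -h')
  have hj : Function.Injective (ρ.comp Polynomial.C) := hρ.comp Polynomial.C_injective
  let j : FractionRing D →+* L := IsFractionRing.lift hj
  have hjd : ∀ d : D, j (algebraMap D _ d) = ρ (Polynomial.C d) := fun d =>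
    IsFractionRing.lift_algebraMap hj d
  refine ⟨(localizationSubring L Q).comap j, fun d hd => (hint d ?_).isAlgebraic, ?_⟩
  · rw [← hjd]
    exact hd
  · refine Subring.closure_le.mpr ?_
    rintro _ ⟨d, hd, rfl⟩
    change j (algebraMap D _ d)⁻¹ ∈ localizationSubring L Q
    rw [map_inv₀, hjd]
    exact hinv d hd

variable {K : Type u} [Field K] {n : ℕ} (I : Ideal (MvPolynomial (Fin n) K)) [hI : I.IsPrime]

/-- The homogeneous coordinate ring of the projective closure. -/
abbrev HomogeneousCoordinateRing (I : Ideal (MvPolynomial (Fin n) K)) : Type u :=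
  MvPolynomial (Fin (n + 1)) K ⧸ (homogenization I).toIdeal

/-- The embedding of the homogeneous coordinate ring into the polynomial ring over `K[X]`. -/
noncomputable def reesEmbedding (I : Ideal (MvPolynomial (Fin n) K)) :
    HomogeneousCoordinateRing I →+* Polynomial (MvPolynomial (Fin n) K ⧸ I) :=
  Ideal.Quotient.lift _ (reesHom I).toRingHom fun F hF => (reesHom_eq_zero_iff I F).mpr hF

theorem reesEmbedding_injective (I : Ideal (MvPolynomial (Fin n) K)) :
    Function.Injective (reesEmbedding I) := by
  rw [injective_iff_map_eq_zero]
  intro x hx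
  obtain ⟨F, rfl⟩ := Ideal.Quotient.mk_surjective x
  exact Ideal.Quotient.eq_zero_iff_mem.mpr ((reesHom_eq_zero_iff I F).mp hx)

theorem coeff_zero_reesHom (I : Ideal (MvPolynomial (Fin n) K)) (F : MvPolynomial (Fin (n + 1)) K) :
    (reesHom I F).coeff 0 = algebraMap K _ (constantCoeff F) := by
  rw [coeff_reesHom, homogeneousComponent_zero, ← constantCoeff_eq]
  change Ideal.Quotient.mk I (dehomogenize K n (algebraMap K _ _)) = _
  rw [AlgHom.commutes]
  rfl

theorem isIntegral_of_reesEmbedding_isIntegralElem {d : MvPolynomial (Fin n) K ⧸ I}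
    (h : (reesEmbedding I).IsIntegralElem (Polynomial.C d)) : IsIntegral K d := by
  -- Setting `T = 0` sends `S` into `K` and fixes the constant polynomial `d`, turning an integral
  -- equation over `S` into one over `K`.
  let φ : HomogeneousCoordinateRing I →+* K := Ideal.Quotient.lift _ constantCoeff fun F hF => by
    apply (algebraMap K (MvPolynomial (Fin n) K ⧸ I)).injective
    rw [← coeff_zero_reesHom, (reesHom_eq_zero_iff I F).mpr hF, map_zero, Polynomial.coeff_zero]
  have hφ : (algebraMap K (MvPolynomial (Fin n) K ⧸ I)).comp φ =
      Polynomial.constantCoeff.comp (reesEmbedding I) := by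
    refine Ideal.Quotient.ringHom_ext (RingHom.ext fun F => ?_)
    exact (coeff_zero_reesHom I F).symm
  obtain ⟨f, hf, h0⟩ := h
  refine ⟨f.map φ, hf.map φ, ?_⟩
  rw [Polynomial.eval₂_map, hφ]
  have h1 := congrArg Polynomial.constantCoeff h0
  rwa [Polynomial.hom_eval₂, map_zero, Polynomial.constantCoeff_apply, Polynomial.coeff_C_zero] at h1

theorem exists_subring_fractionRing (hdim : ringKrullDim (MvPolynomial (Fin n) K ⧸ I) = 2)
    (hirr : IsIrreducible (pointsAtInfinity I))
    (hns : ∃ p ∈ pointsAtInfinity I, IsNonsingularPoint (projClosure I) p) :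
    ∃ V : Subring (FractionRing (MvPolynomial (Fin n) K ⧸ I)),
      (∀ d : MvPolynomial (Fin n) K ⧸ I, algebraMap _ _ d ∈ V → IsAlgebraic K d) ∧
      reciprocalComplement (MvPolynomial (Fin n) K ⧸ I) ≤ V := by
  have hqp : (idealAtInfinity I).toIdeal.IsPrime := vanishingIdeal_isPrime_of_isIrreducible hirr
  have hJq := homogenization_le_idealAtInfinity I
  let mk : MvPolynomial (Fin (n + 1)) K →+* HomogeneousCoordinateRing I :=
    Ideal.Quotient.mk (homogenization I).toIdeal
  let Q : Ideal (HomogeneousCoordinateRing I) := (idealAtInfinity I).toIdeal.map mk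
  have hQ : ∀ F, mk F ∈ Q ↔ F ∈ (idealAtInfinity I).toIdeal := fun F =>
    Ideal.mem_quotient_iff_mem hJq
  have : Q.IsPrime := Ideal.map_isPrime_of_surjective Ideal.Quotient.mk_surjective (by
    rwa [Ideal.mk_ker])
  obtain ⟨A, hA, hgen⟩ := exists_generator_idealAtInfinity I hdim hirr hns
  refine exists_subring_fractionRing_of_rees (K := K) (reesEmbedding I) (reesEmbedding_injective I)
    (reesHom I).commutes (fun d => ?_) (fun d => isIntegral_of_reesEmbedding_isIntegralElem I)
    Q (t := mk (X 0)) (reesHom_X_zero I) ((hQ _).mpr (X_zero_mem_idealAtInfinity I))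
    (fun P hP htP => ?_) (x := mk A) ((hQ A).mpr hA) fun y hy => ?_
  · obtain ⟨k, F, hF⟩ := exists_reesHom_eq I d
    exact ⟨k, mk F, hF⟩
  · refine Ideal.map_le_iff_le_comap.mpr (idealAtInfinity_le_of_isPrime I hirr.1 _ ?_ htP)
    intro F hF
    rw [Ideal.mem_comap, Ideal.Quotient.eq_zero_iff_mem.mpr hF]
    exact P.zero_mem
  · obtain ⟨F, rfl⟩ := Ideal.Quotient.mk_surjective y
    obtain ⟨s, hs, z, hz⟩ := hgen F ((hQ F).mp hy)
    refine ⟨mk s, fun h => hs ((hQ s).mp h), mk z, ?_⟩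
    have := Ideal.Quotient.eq.mpr hz
    rw [map_mul, map_mul] at this
    exact this

end

theorem one_le_ringKrullDim_of_not_isField {R : Type*} [CommRing R] [IsDomain R]
    (h : ¬ IsField R) : 1 ≤ ringKrullDim R := by
  by_contra hlt
  refine h ?_
  have : Ring.KrullDimLE 0 R := Ring.krullDimLE_iff.mpr (by
    rw [not_le] at hlt
    generalize ringKrullDim R = a at hlt ⊢
    induction a with
    | bot => exact bot_le
    | coe a => exact_mod_cast (Order.lt_one_iff.mp (by exact_mod_cast hlt)).le)
  exact Ring.KrullDimLE.isField_of_isDomain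

theorem proposition3p14 {K : Type*} [Field K] {n : ℕ}
    (I : Ideal (MvPolynomial (Fin n) K)) [I.IsPrime]
    (hdim : ringKrullDim (MvPolynomial (Fin n) K ⧸ I) = 2)
    (hirr : IsIrreducible (pointsAtInfinity I))
    (hns : ∃ p ∈ pointsAtInfinity I, IsNonsingularPoint (projClosure I) p) :
    ((∀ f : MvPolynomial (Fin n) K ⧸ I, IsAlgebraic K f →
          f ∈ (algebraMap K (MvPolynomial (Fin n) K ⧸ I)).range) →
        (algebraMap (MvPolynomial (Fin n) K ⧸ I)
            (FractionRing (MvPolynomial (Fin n) K ⧸ I))).range ⊓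
          reciprocalComplement (MvPolynomial (Fin n) K ⧸ I) =
        (algebraMap K (FractionRing (MvPolynomial (Fin n) K ⧸ I))).range) ∧
      1 ≤ ringKrullDim (reciprocalComplement (MvPolynomial (Fin n) K ⧸ I)) := by
  obtain ⟨V, hV, hle⟩ := exists_subring_fractionRing I hdim hirr hns
  refine ⟨fun hK => le_antisymm ?_ ?_, one_le_ringKrullDim_of_not_isField fun hfield => ?_⟩
  · rintro _ ⟨⟨d, rfl⟩, hd⟩
    obtain ⟨a, rfl⟩ := hK d (hV d (hle hd))
    exact ⟨a, IsScalarTower.algebraMap_apply K (MvPolynomial (Fin n) K ⧸ I) _ a⟩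
  · rintro _ ⟨a, rfl⟩
    rw [IsScalarTower.algebraMap_apply K (MvPolynomial (Fin n) K ⧸ I)]
    refine ⟨⟨_, rfl⟩, ?_⟩
    by_cases ha : a = 0
    · rw [ha, map_zero, map_zero]
      exact zero_mem _
    · refine Subring.subset_closure ⟨algebraMap K _ a⁻¹, ?_, ?_⟩
      · rw [Ne, map_eq_zero]
        exact inv_ne_zero ha
      · rw [← IsScalarTower.algebraMap_apply, ← IsScalarTower.algebraMap_apply, map_inv₀, inv_inv]
  -- Were every element algebraic, the coordinate ring would be a field, of dimension 0 instead of
  -- 2. If the reciprocal complement were a field, it would contain the inverse of `d⁻¹`, so the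
  -- transcendental `d` would lie in `V`.
  · obtain ⟨d, hd⟩ : ∃ d : MvPolynomial (Fin n) K ⧸ I, ¬ IsAlgebraic K d := by
      by_contra! h
      have : Algebra.IsIntegral K (MvPolynomial (Fin n) K ⧸ I) := ⟨fun d => (h d).isIntegral⟩
      have := ringKrullDim_eq_zero_of_isField (isField_of_isIntegral_of_isField'
        (S := MvPolynomial (Fin n) K ⧸ I) (Field.toIsField K))
      rw [this] at hdim
      norm_num at hdim
    refine hd (hV d (hle ?_))
    have hd0 : d ≠ 0 := by
      rintro rfl
      exact hd isAlgebraic_zero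
    have hd0' : algebraMap _ (FractionRing (MvPolynomial (Fin n) K ⧸ I)) d ≠ 0 := by
      rwa [Ne, map_eq_zero_iff _ (IsFractionRing.injective _ _)]
    let r : reciprocalComplement (MvPolynomial (Fin n) K ⧸ I) :=
      ⟨(algebraMap _ _ d)⁻¹, Subring.subset_closure ⟨d, hd0, rfl⟩⟩
    obtain ⟨y, hy⟩ := hfield.mul_inv_cancel
      (a := r) fun h => inv_ne_zero hd0' (congrArg Subtype.val h)
    have hy' : (algebraMap _ _ d)⁻¹ * (y : FractionRing (MvPolynomial (Fin n) K ⧸ I)) = 1 :=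
      congrArg Subtype.val hy
    rw [inv_mul_eq_iff_eq_mul₀ hd0', mul_one] at hy'
    rw [← hy']
    exact y.2
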